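/- Let $M$ be a smooth manifold of dimension $m$ with a volume form $s\in\Omega^{m}(M)$ (a nowhere vanishing top-degree form), and let $A\to M$ be a smooth real vector bundle of rank $n$ with dual $A^*$. Let $(A,[\cdot,\cdot],\rho)$ and $(A^*,[\cdot,\cdot]_*,\rho_*)$ be Lie algebroids such that $(A,A^*)$ is a Lie bialgebroid, i.e. the Lie algebroid differential $d_*$ of $A^*$ is a derivation of the Gerstenhaber algebra $(\Gamma(\wedge^\bullet A),\wedge,[\cdot,\cdot])$: $$d_*[u,v]=[d_*u,v]+(-1)^{k-1}[u,d_*v]\qquad\text{for all }u\in\Gamma(\wedge^kA),\ v\in\Gamma(\wedge^lA).$$ Assume that there is a nowhere vanishing section $\Omega\in\Gamma(\wedge^nA^*)$, and let $V\in\Gamma(\wedge^nA)$ be its dual, $\langle\Omega,V\rangle=1$. For $u\in\Gamma(A)$ let $L_uV=[u,V]$, and for $\theta\in\Gamma(A^*)$ let $L_\theta\Omega=[\theta,\Omega]_*$. Let $X_0\in\Gamma(A)$ and $\xi_0\in\Gamma(A^*)$ be the modular cocycles, defined by $$(L_\theta\Omega)\otimes s+\Omega\otimes L_{\rho_*(\theta)}s=\langle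 X_0,\theta\rangle\,\Omega\otimes s\quad\text{for all }\theta\in\Gamma(A^*),$$ $$(L_{\rho(u)}s)\otimes V+s\otimes L_uV=\langle\xi_0,u\rangle\,s\otimes V\quad\text{for all }u\in\Gamma(A).$$ Then the bundle map $\pi^\sharp=\rho\circ(\rho_*)^*:T^*M\to TM$ is that of a Poisson bivector $\pi$ on $M$, and the modular vector field of $(M,\pi)$ with respect to $s$, i.e. the unique vector field $X_s$ such that $L_{\pi^\sharp(df)}s=X_s(f)\,s$ for all $f\in C^\infty(M)$, is $$X_s=\tfrac12\big(\rho_*(\xi_0)-\rho(X_0)\big).$$ -/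

import Mathlib

open Bundle VectorField
open scoped Manifold ContDiff

noncomputable section

/-! ## Algebra of cochains

`R` is the algebra of smooth functions, `N` and `N'` are the spaces of sections of a vector bundle
and of its dual, `pair θ X = ⟨θ, X⟩`, `br` is the bracket of a Lie algebroid structure on the first
bundle, and `act X f = ρ(X) f`, with `ρ` the anchor. A `k`-cochain on `N` is a function
`(Fin k → N) → R`; the alternating `C^∞`-multilinear ones are the sections of the `k`-th exterior
power of the bundle dual to the one of which `N` is the space of sections. -/

namespace Cochain

variable {R N N' : Type*} [CommRing R] [Algebra ℝ R] [AddCommGroup N] [AddCommGroup N']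

/-- The Lie algebroid (Chevalley-Eilenberg) differential
`(dα)(X₀,…,Xₖ) = ∑ⱼ (-1)ʲ ρ(Xⱼ) α(X₀,…,X̂ⱼ,…,Xₖ) + ∑_{i<j} (-1)^{i+j} α([Xᵢ,Xⱼ],X₀,…,X̂ᵢ,…,X̂ⱼ,…,Xₖ)`.
In the second sum the argument `[Xᵢ,Xⱼ]` is written in place of `Xᵢ`; for alternating `α`, moving it
to the front produces the sign `(-1)ⁱ`. -/
def d (act : N → R → R) (br : N → N → N) {k : ℕ} (α : (Fin k → N) → R) :
    (Fin (k + 1) → N) → R := fun X ↦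
  ∑ j : Fin (k + 1), (-1 : R) ^ (j : ℕ) * act (X j) (α fun i ↦ X (j.succAbove i)) +
    ∑ j : Fin (k + 1), ∑ i : Fin k,
      if i.castSucc < j then
        (-1 : R) ^ (j : ℕ) *
          α (Function.update (fun l ↦ X (j.succAbove l)) i (br (X i.castSucc) (X j)))
      else 0

/-- The Lie derivative of a form: `(L_X α)(Y₁,…,Yₖ) = ρ(X) α(Y₁,…,Yₖ) - ∑ᵢ α(Y₁,…,[X,Yᵢ],…,Yₖ)`. -/
def lieForm (act : N → R → R) (br : N → N → N) {k : ℕ} (X : N) (α : (Fin k → N) → R) :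
    (Fin k → N) → R := fun Y ↦
  act X (α Y) - ∑ i, α (Function.update Y i (br X (Y i)))

open Classical in
/-- The section `X` with `⟨θ, X⟩ = φ θ` for all `θ`. For sections of a finite rank vector bundle and
of its dual it exists and is unique as soon as `φ` is `C^∞`-linear (and likewise for vectors of a
finite-dimensional space and a linear `φ`), which is the case wherever it is applied below to
alternating `C^∞`-multilinear cochains; the value `0` is a convention for the remaining `φ`. -/
def representer (pair : N' → N → R) (φ : N' → R) : N :=
  if h : ∃ X, ∀ θ, pair θ X = φ θ then h.choose else 0

/-- The Lie derivative of a section of the dual bundle, determined by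
`⟨L_X θ, Y⟩ = ρ(X)⟨θ, Y⟩ - ⟨θ, [X, Y]⟩`. -/
def lieDual (act : N → R → R) (br : N → N → N) (pair : N' → N → R) (X : N) (θ : N') : N' :=
  representer (fun Y η ↦ pair η Y) fun Y ↦ act X (pair θ Y) - pair θ (br X Y)

/-- The Lie derivative `L_X P = [X, P]` of a section `P` of the `k`-th exterior power of the bundle
that carries the Lie algebroid structure, `P` being regarded as a form on the dual bundle:
`(L_X P)(θ₁,…,θₖ) = ρ(X) P(θ₁,…,θₖ) - ∑ᵢ P(θ₁,…,L_X θᵢ,…,θₖ)`. -/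
def lieMulti (act : N → R → R) (br : N → N → N) (pair : N' → N → R) {k : ℕ} (X : N)
    (P : (Fin k → N') → R) : (Fin k → N') → R := fun θ ↦
  act X (P θ) - ∑ i, P (Function.update θ i (lieDual act br pair X (θ i)))

/-- The section `P(·, θ₁, …, θₚ)`. -/
def sharp (pair : N' → N → R) {p : ℕ} (P : (Fin (p + 1) → N') → R) (θ : Fin p → N') : N :=
  representer pair fun η ↦ P (Fin.cons η θ)

/-- The `j`-th entry of a tuple (counted from `0`). -/
def entry {n : ℕ} (θ : Fin n → N') (j : ℕ) : N' := if h : j < n then θ ⟨j, h⟩ else 0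

/-- The `r` consecutive entries `θ_a, …, θ_{a+r-1}` of a tuple. -/
def slice {n : ℕ} (θ : Fin n → N') (a r : ℕ) : Fin r → N' := fun i ↦ entry θ (a + i)

/-- The antisymmetrization of `ρ(P(·, θ₁, …, θₚ)) Q(θ_{p+1}, …, θ_{p+l})`, i.e. the signed sum over
the `(p, l)`-shuffles; here `n = p + l`. -/
def derivTerm (act : N → R → R) (pair : N' → N → R) {p l : ℕ} (n : ℕ)
    (P : (Fin (p + 1) → N') → R) (Q : (Fin l → N') → R) : (Fin n → N') → R := fun θ ↦
  ∑ σ : Equiv.Perm (Fin n), (((Equiv.Perm.sign σ : ℤ) : ℝ) / (p.factorial * l.factorial)) •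
    act (sharp pair P (slice (θ ∘ σ) 0 p)) (Q (slice (θ ∘ σ) p l))

/-- The differential of a section `θ` of the dual bundle, evaluated on two sections. -/
def dTwo (act : N → R → R) (br : N → N → N) (pair : N' → N → R) (θ : N') (X Y : N) : R :=
  act X (pair θ Y) - act Y (pair θ X) - pair θ (br X Y)

/-- The antisymmetrization of `(dθ₀)(P(·, θ₁, …, θₚ), Q(·, θ_{p+1}, …, θ_{p+q}))`, i.e. the signed
sum over the `(1, p, q)`-shuffles; here `n = p + q + 1`. -/
def contractTerm (act : N → R → R) (br : N → N → N) (pair : N' → N → R) {p q : ℕ} (n : ℕ)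
    (P : (Fin (p + 1) → N') → R) (Q : (Fin (q + 1) → N') → R) : (Fin n → N') → R := fun θ ↦
  ∑ σ : Equiv.Perm (Fin n), (((Equiv.Perm.sign σ : ℤ) : ℝ) / (p.factorial * q.factorial)) •
    dTwo act br pair (entry (θ ∘ σ) 0) (sharp pair P (slice (θ ∘ σ) 1 p))
      (sharp pair Q (slice (θ ∘ σ) (1 + p) q))

/-- The Gerstenhaber (Schouten) bracket `[P, Q]` of a `k`-vector `P` and an `l`-vector `Q` of a Lie
algebroid, as an `n`-vector with `n = k + l - 1`. It is the biadditive extension of `[X, Y]`,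
`[X, f] = ρ(X) f`, `[f, g] = 0` with
`[X₁∧⋯∧Xₖ, Y₁∧⋯∧Yₗ] = ∑ (-1)^{i+j} [Xᵢ,Yⱼ]∧X₁∧⋯X̂ᵢ⋯∧Xₖ∧Y₁∧⋯Ŷⱼ⋯∧Yₗ` and
`[P, f] = (-1)^{k-1} P(·, …, ·)` contracted in its first argument with `df`, `[f, Q] = -ι_{df} Q`,
written in closed form by means of
`⟨θ, [X, Y]⟩ = ρ(X)⟨θ, Y⟩ - ρ(Y)⟨θ, X⟩ - dθ(X, Y)`. -/
def schouten (act : N → R → R) (br : N → N → N) (pair : N' → N → R) (n : ℕ) :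
    {k l : ℕ} → ((Fin k → N') → R) → ((Fin l → N') → R) → ((Fin n → N') → R)
  | 0, 0, _, _ => 0
  | p + 1, 0, P, Q => (-1 : R) ^ p • derivTerm act pair n P Q
  | 0, _ + 1, P, Q => -derivTerm act pair n Q P
  | p + 1, q + 1, P, Q =>
      (-1 : R) ^ p • derivTerm act pair n P Q - (-1 : R) ^ (q * (p + 1)) • derivTerm act pair n Q P -
        contractTerm act br pair n P Q

end Cochain

/-! ## Functions, vector fields and forms on a manifold -/

section Manifold

variable (m : ℕ) (M : Type*) [TopologicalSpace M] [ChartedSpace (EuclideanSpace ℝ (Fin m)) M]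

/-- The algebra `C^∞(M)`. -/
abbrev SmoothFun : Type _ := C^∞⟮𝓡 m, M; 𝓘(ℝ, ℝ), ℝ⟯

variable [IsManifold (𝓡 m) ∞ M]

/-- Smooth vector fields on `M`. -/
abbrev VectorFields : Type _ :=
  Cₛ^∞⟮𝓡 m; EuclideanSpace ℝ (Fin m), fun x : M ↦ TangentSpace (𝓡 m) x⟯

/-- Smooth sections of the cotangent bundle `T*M`. -/
abbrev OneForms : Type _ :=
  Cₛ^∞⟮𝓡 m; EuclideanSpace ℝ (Fin m) →L[ℝ] ℝ, fun x : M ↦ TangentSpace (𝓡 m) x →L[ℝ] ℝ⟯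

variable {m M}

/-- The de Rham differential `df` of a function. -/
def differential (f : SmoothFun m M) : OneForms m M where
  toFun x := mfderiv (𝓡 m) 𝓘(ℝ, ℝ) f x
  contMDiff_toFun x := by
    rw [contMDiffAt_hom_bundle]
    refine ⟨contMDiffAt_id, ?_⟩
    have := (f.contMDiff x).mfderiv_const (m := ∞) (by simp)
    refine this.congr_of_eventuallyEq (Filter.Eventually.of_forall fun y ↦ ?_)
    ext v
    simp [inTangentCoordinates, ContinuousLinearMap.inCoordinates]
    rfl

/-- The derivative `X(f)` of a function along a vector field. -/
def VectorFields.act (X : VectorFields m M) (f : SmoothFun m M) : SmoothFun m M where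
  val x := mfderiv (𝓡 m) 𝓘(ℝ, ℝ) f x (X x)
  property x := by
    have := (differential f).contMDiff.clm_bundle_apply X.contMDiff x
    rw [contMDiffAt_section] at this
    exact this

/-- The Lie bracket of vector fields. -/
def VectorFields.bracket (X Y : VectorFields m M) : VectorFields m M where
  toFun := mlieBracket (𝓡 m) X Y
  contMDiff_toFun x := by
    have : IsManifold (𝓡 m) (minSmoothness ℝ 2) M := by
      rw [minSmoothness_of_isRCLikeNormedField]
      exact IsManifold.of_le (n := ∞) (WithTop.coe_le_coe.2 le_top)
    have : IsManifold (𝓡 m) (((⊤ : ℕ∞) : WithTop ℕ∞) + 1) M := ‹IsManifold (𝓡 m) ∞ M›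
    exact ContMDiffAt.mlieBracket_vectorField (m := ⊤) (n := ⊤) (X.contMDiff x) (Y.contMDiff x)
      (by simp)

end Manifold

/-! ## Vector bundles and Lie algebroids -/

section Bundle

variable (m : ℕ) {M : Type*} [TopologicalSpace M] [ChartedSpace (EuclideanSpace ℝ (Fin m)) M]
  (F : Type*) [NormedAddCommGroup F] [NormedSpace ℝ F]
  (E : M → Type*) [∀ x, AddCommGroup (E x)] [∀ x, Module ℝ (E x)] [∀ x, TopologicalSpace (E x)]
  [TopologicalSpace (TotalSpace F E)] [FiberBundle F E]

/-- Smooth sections of the `k`-th exterior power of the dual bundle `E*`: smooth families of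
alternating `k`-linear forms on the fibres of `E`. Applied to `E = A*`, these are the smooth sections
of the `k`-th exterior power of `A`. -/
structure FormField (k : ℕ) where
  toFun : ∀ x, E x [⋀^Fin k]→ₗ[ℝ] ℝ
  smooth : ∀ X : Fin k → Cₛ^∞⟮𝓡 m; F, E⟯,
    ContMDiff (𝓡 m) 𝓘(ℝ, ℝ) ∞ fun x ↦ toFun x fun i ↦ X i x

variable {m F E} in
/-- The function `w(X₁, …, Xₖ)`. -/
def FormField.eval {k : ℕ} (w : FormField m F E k) (X : Fin k → Cₛ^∞⟮𝓡 m; F, E⟯) :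
    SmoothFun m M :=
  ⟨fun x ↦ w.toFun x fun i ↦ X i x, w.smooth X⟩

variable [VectorBundle ℝ F E] [IsManifold (𝓡 m) ∞ M]

variable {m F E} in
/-- The product `f X` of a function and a section. -/
def mulSection (f : SmoothFun m M) (X : Cₛ^∞⟮𝓡 m; F, E⟯) : Cₛ^∞⟮𝓡 m; F, E⟯ :=
  ⟨fun x ↦ f x • X x, f.contMDiff.smul_section X.contMDiff⟩

/-- A Lie algebroid structure on the vector bundle `E` (with typical fibre `F`) over `M`: the anchor
is a smooth bundle map `E → TM`, i.e. a smooth section of `Hom(E, TM)`. -/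
structure LieAlgebroid where
  anchor : Cₛ^∞⟮𝓡 m; F →L[ℝ] EuclideanSpace ℝ (Fin m), fun x ↦ E x →L[ℝ] TangentSpace (𝓡 m) x⟯
  bracket : Cₛ^∞⟮𝓡 m; F, E⟯ →ₗ[ℝ] Cₛ^∞⟮𝓡 m; F, E⟯ →ₗ[ℝ] Cₛ^∞⟮𝓡 m; F, E⟯
  bracket_self : ∀ X, bracket X X = 0
  jacobi : ∀ X Y Z, bracket X (bracket Y Z) = bracket (bracket X Y) Z + bracket Y (bracket X Z)
  anchor_bracket : ∀ X Y x, anchor x (bracket X Y x) =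
    mlieBracket (𝓡 m) (fun y ↦ anchor y (X y)) (fun y ↦ anchor y (Y y)) x
  leibniz : ∀ X Y (f : SmoothFun m M) x, bracket X (mulSection f Y) x =
    (show ℝ from mfderiv (𝓡 m) 𝓘(ℝ, ℝ) f x (anchor x (X x))) • Y x + f x • bracket X Y x

variable {m F E}

/-- The vector field `ρ(X)`. -/
def LieAlgebroid.rho (L : LieAlgebroid m F E) (X : Cₛ^∞⟮𝓡 m; F, E⟯) : VectorFields m M :=
  ⟨fun x ↦ L.anchor x (X x), L.anchor.contMDiff.clm_bundle_apply X.contMDiff⟩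

/-- The function `ρ(X) f`. -/
def LieAlgebroid.act (L : LieAlgebroid m F E) (X : Cₛ^∞⟮𝓡 m; F, E⟯) (f : SmoothFun m M) :
    SmoothFun m M :=
  (L.rho X).act f

/-- The bracket of sections as a function of two variables. -/
def LieAlgebroid.br (L : LieAlgebroid m F E) (X Y : Cₛ^∞⟮𝓡 m; F, E⟯) : Cₛ^∞⟮𝓡 m; F, E⟯ :=
  L.bracket X Y

/-- The duality pairing `⟨θ, X⟩` of a section of `E*` and a section of `E`. -/
def pairing (θ : Cₛ^∞⟮𝓡 m; F →L[ℝ] ℝ, fun x ↦ E x →L[ℝ] ℝ⟯) (X : Cₛ^∞⟮𝓡 m; F, E⟯) :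
    SmoothFun m M where
  val x := θ x (X x)
  property x := by
    have := θ.contMDiff.clm_bundle_apply (E₂ := fun _ ↦ ℝ) X.contMDiff x
    rw [contMDiffAt_section] at this
    exact this

/-- The duality pairing with the arguments exchanged. -/
def pairing' (X : Cₛ^∞⟮𝓡 m; F, E⟯) (θ : Cₛ^∞⟮𝓡 m; F →L[ℝ] ℝ, fun x ↦ E x →L[ℝ] ℝ⟯) :
    SmoothFun m M :=
  pairing θ X

end Bundle

/-! ## Lie bialgebroids and modular vector fields -/

section Bialgebroid

variable {m : ℕ} {M : Type*} [TopologicalSpace M] [ChartedSpace (EuclideanSpace ℝ (Fin m)) M]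
  [IsManifold (𝓡 m) ∞ M]
  {F : Type*} [NormedAddCommGroup F] [NormedSpace ℝ F]
  {A : M → Type*} [∀ x, AddCommGroup (A x)] [∀ x, Module ℝ (A x)] [∀ x, TopologicalSpace (A x)]
  [TopologicalSpace (TotalSpace F A)] [FiberBundle F A] [VectorBundle ℝ F A]

/-- A pair of Lie algebroid structures on `A` and on `A*` is a Lie bialgebroid if the differential
`d⁎` of the Lie algebroid `A*` is a derivation of the Gerstenhaber algebra of sections of the
exterior powers of `A`: `d⁎[P, Q] = [d⁎P, Q] + (-1)^{k-1} [P, d⁎Q]` for every `k`-vector `P` and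
`l`-vector `Q`. The case `k = l = 0`, in which `[P, Q] = 0`, is listed separately. -/
structure IsLieBialgebroid (L : LieAlgebroid m F A)
    (L' : LieAlgebroid m (F →L[ℝ] ℝ) fun x ↦ A x →L[ℝ] ℝ) : Prop where
  zero_zero : ∀ P Q : FormField m (F →L[ℝ] ℝ) (fun x ↦ A x →L[ℝ] ℝ) 0,
    Cochain.schouten L.act L.br pairing 0 (Cochain.d L'.act L'.br P.eval) Q.eval -
      Cochain.schouten L.act L.br pairing 0 P.eval (Cochain.d L'.act L'.br Q.eval) = 0
  derivation : ∀ (k l n : ℕ), n + 1 = k + l →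
    ∀ (P : FormField m (F →L[ℝ] ℝ) (fun x ↦ A x →L[ℝ] ℝ) k)
      (Q : FormField m (F →L[ℝ] ℝ) (fun x ↦ A x →L[ℝ] ℝ) l),
      Cochain.d L'.act L'.br (Cochain.schouten L.act L.br pairing n P.eval Q.eval) =
        Cochain.schouten L.act L.br pairing (n + 1) (Cochain.d L'.act L'.br P.eval) Q.eval +
          (-1 : SmoothFun m M) ^ (k + 1) •
            Cochain.schouten L.act L.br pairing (n + 1) P.eval (Cochain.d L'.act L'.br Q.eval)

/-- The transpose `T*ₓM → Aₓ` of the anchor of a Lie algebroid structure on `A*`: the vector `a`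
with `⟨φ, a⟩ = ⟨α, ρ⁎(φ)⟩` for all `φ` in the fibre of `A*`. -/
def LieAlgebroid.anchorTranspose (L' : LieAlgebroid m (F →L[ℝ] ℝ) fun x ↦ A x →L[ℝ] ℝ) (x : M)
    (α : TangentSpace (𝓡 m) x →L[ℝ] ℝ) : A x :=
  Cochain.representer (fun (φ : A x →L[ℝ] ℝ) (a : A x) ↦ φ a) fun φ ↦ α (L'.anchor x φ)

/-- Sections `Ω` of the top exterior power of `A*` and `V` of that of `A` are dual to each other,
`⟨Ω, V⟩ = 1`. For `Ω = w e¹∧⋯∧eⁿ` and `V = v e₁∧⋯∧eₙ` in dual bases one has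
`Ω(X₁,…,Xₙ) V(θ₁,…,θₙ) = w v det ⟨θᵢ, Xⱼ⟩`, so that the identity below says `w v = 1`. -/
def IsDualVolume {n : ℕ} (Ω : FormField m F A n)
    (V : FormField m (F →L[ℝ] ℝ) (fun x ↦ A x →L[ℝ] ℝ) n) : Prop :=
  ∀ (x : M) (X : Fin n → A x) (θ : Fin n → A x →L[ℝ] ℝ),
    Ω.toFun x X * V.toFun x θ = (Matrix.of fun i j ↦ θ i (X j)).det

/-- The section `ξ₀` of `A*` is the modular cocycle of the Lie algebroid `A` with respect to `s ⊗ V`: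
`(L_{ρ(u)} s) ⊗ V + s ⊗ L_u V = ⟨ξ₀, u⟩ s ⊗ V` for all sections `u` of `A`. -/
def IsModularCocycle {n : ℕ} (L : LieAlgebroid m F A)
    (s : FormField m (EuclideanSpace ℝ (Fin m)) (fun x : M ↦ TangentSpace (𝓡 m) x) m)
    (V : FormField m (F →L[ℝ] ℝ) (fun x ↦ A x →L[ℝ] ℝ) n)
    (ξ₀ : Cₛ^∞⟮𝓡 m; F →L[ℝ] ℝ, fun x ↦ A x →L[ℝ] ℝ⟯) : Prop :=
  ∀ (u : Cₛ^∞⟮𝓡 m; F, A⟯) (Y : Fin m → VectorFields m M)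
    (θ : Fin n → Cₛ^∞⟮𝓡 m; F →L[ℝ] ℝ, fun x ↦ A x →L[ℝ] ℝ⟯),
    Cochain.lieForm VectorFields.act VectorFields.bracket (L.rho u) s.eval Y * V.eval θ +
        s.eval Y * Cochain.lieMulti L.act L.br pairing u V.eval θ =
      pairing ξ₀ u * (s.eval Y * V.eval θ)

/-- The section `X₀` of `A` is the modular cocycle of the Lie algebroid `A*` with respect to `Ω ⊗ s`:
`(L_θ Ω) ⊗ s + Ω ⊗ L_{ρ⁎(θ)} s = ⟨X₀, θ⟩ Ω ⊗ s` for all sections `θ` of `A*`. -/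
def IsDualModularCocycle {n : ℕ} (L' : LieAlgebroid m (F →L[ℝ] ℝ) fun x ↦ A x →L[ℝ] ℝ)
    (s : FormField m (EuclideanSpace ℝ (Fin m)) (fun x : M ↦ TangentSpace (𝓡 m) x) m)
    (Ω : FormField m F A n) (X₀ : Cₛ^∞⟮𝓡 m; F, A⟯) : Prop :=
  ∀ (θ : Cₛ^∞⟮𝓡 m; F →L[ℝ] ℝ, fun x ↦ A x →L[ℝ] ℝ⟯) (X : Fin n → Cₛ^∞⟮𝓡 m; F, A⟯)
    (Y : Fin m → VectorFields m M),
    Cochain.lieMulti L'.act L'.br pairing' θ Ω.eval X * s.eval Y +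
        Ω.eval X * Cochain.lieForm VectorFields.act VectorFields.bracket (L'.rho θ) s.eval Y =
      pairing θ X₀ * (Ω.eval X * s.eval Y)

end Bialgebroid

section Poisson

variable (m : ℕ) (M : Type*) [TopologicalSpace M] [ChartedSpace (EuclideanSpace ℝ (Fin m)) M]
  [IsManifold (𝓡 m) ∞ M]

/-- A smooth bivector field `π` on `M`, given by the skew-symmetric bundle map `π♯ : T*M → TM` with
`π(α, β) = ⟨β, π♯ α⟩`. -/
structure BivectorField where
  sharp : Cₛ^∞⟮𝓡 m; (EuclideanSpace ℝ (Fin m) →L[ℝ] ℝ) →L[ℝ] EuclideanSpace ℝ (Fin m),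
    fun x : M ↦ (TangentSpace (𝓡 m) x →L[ℝ] ℝ) →L[ℝ] TangentSpace (𝓡 m) x⟯
  skew : ∀ (x : M) (α β : TangentSpace (𝓡 m) x →L[ℝ] ℝ), β (sharp x α) = -α (sharp x β)

variable {m M}

/-- The Hamiltonian vector field `π♯(df)` of `f` with respect to the bivector field `π = P`. -/
def BivectorField.ham (P : BivectorField m M) (f : SmoothFun m M) : VectorFields m M :=
  ⟨fun x ↦ P.sharp x (differential f x),
    P.sharp.contMDiff.clm_bundle_apply (differential f).contMDiff⟩

/-- The bracket `{f, g} = π(df, dg) = π♯(df)(g)`, where `π = P`. -/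
def BivectorField.poissonBracket (P : BivectorField m M) (f g : SmoothFun m M) : SmoothFun m M :=
  (P.ham f).act g

/-- The bivector field is a Poisson bivector: `{·, ·}` satisfies the Jacobi identity. -/
def BivectorField.IsPoisson (P : BivectorField m M) : Prop :=
  ∀ f g h : SmoothFun m M, P.poissonBracket f (P.poissonBracket g h) =
    P.poissonBracket (P.poissonBracket f g) h + P.poissonBracket g (P.poissonBracket f h)

/-- `Z` is the modular vector field of `π = P` with respect to the volume form `s`:
`L_{π♯(df)} s = Z(f) s` for all functions `f`. -/
def BivectorField.IsModularVectorField (P : BivectorField m M)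
    (s : FormField m (EuclideanSpace ℝ (Fin m)) (fun x : M ↦ TangentSpace (𝓡 m) x) m)
    (Z : VectorFields m M) : Prop :=
  ∀ (f : SmoothFun m M) (Y : Fin m → VectorFields m M),
    Cochain.lieForm VectorFields.act VectorFields.bracket (P.ham f) s.eval Y =
      Z.act f * s.eval Y

end Poisson

end

open scoped Topology

/-!
For a function `f` put `u = d⁎f ∈ Γ(A)` and `θ = df ∈ Γ(A*)`, so that `ρ(u) = π♯(df)`. The
derivation property of `d⁎` on two functions is the skew-symmetry of `π`, equivalently
`ρ⁎(θ) = -ρ(u)`; on `f` and a section `X` it reads `[u, X] = -L_θ X`, and dually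
`L_u η = -[θ, η]⁎`. Taking `X = d⁎g` gives the Jacobi identity of `π`.

Since `L_u` and `-L_θ` agree on functions and on sections of `A` and `A*`, differentiating
`⟨Ω, V⟩ = 1` shows that `L_θ Ω / Ω = L_u V / V`. The difference of the identities defining `ξ₀` at
`u` and `X₀` at `θ` is therefore
`2 L_{ρ(u)} s = (⟨ξ₀, u⟩ - ⟨θ, X₀⟩) s = (ρ⁎(ξ₀)(f) - ρ(X₀)(f)) s`.
-/

section Frames

variable {m : ℕ} {M : Type*} [TopologicalSpace M] [ChartedSpace (EuclideanSpace ℝ (Fin m)) M]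
  {F : Type*} [NormedAddCommGroup F] [NormedSpace ℝ F]
  {F' : Type*} [NormedAddCommGroup F'] [NormedSpace ℝ F']
  {E : M → Type*} [∀ x, AddCommGroup (E x)] [∀ x, Module ℝ (E x)] [∀ x, TopologicalSpace (E x)]
  [TopologicalSpace (TotalSpace F E)] [FiberBundle F E] [VectorBundle ℝ F E]
  {E' : M → Type*} [∀ x, AddCommGroup (E' x)] [∀ x, Module ℝ (E' x)]
  [∀ x, TopologicalSpace (E' x)] [TopologicalSpace (TotalSpace F' E')] [FiberBundle F' E']
  [VectorBundle ℝ F' E']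

variable (F) in
include F in
theorem dual_separates (x : M) {v w : E x} (h : ∀ φ : E x →L[ℝ] ℝ, φ v = φ w) : v = w := by
  let Φ := VectorBundle.continuousLinearEquivAt ℝ F E x
  apply Φ.injective
  by_contra hne
  obtain ⟨φ, hφ⟩ := SeparatingDual.exists_separating_of_ne (R := ℝ) hne
  exact hφ (h (φ.comp (Φ : E x →L[ℝ] F)))

variable (F) in
theorem continuous_of_linear_of_fiber [FiniteDimensional ℝ F] {x : M} {G : Type*} [AddCommGroup G]
    [Module ℝ G] [TopologicalSpace G] [IsTopologicalAddGroup G] [ContinuousSMul ℝ G]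
    (T : E x →ₗ[ℝ] G) : Continuous T := by
  let Φ := VectorBundle.continuousLinearEquivAt ℝ F E x
  have h : Continuous (T.comp Φ.symm.toLinearEquiv.toLinearMap) :=
    LinearMap.continuous_of_finiteDimensional _
  convert h.comp Φ.continuous using 1
  ext v
  simp

theorem contMDiffAt_clm_of_apply [FiniteDimensional ℝ F] {φ : M → F →L[ℝ] F'} {x : M}
    (h : ∀ v, ContMDiffAt (𝓡 m) 𝓘(ℝ, F') ∞ (fun y ↦ φ y v) x) :
    ContMDiffAt (𝓡 m) 𝓘(ℝ, F →L[ℝ] F') ∞ φ x := by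
  let e₁ : F ≃L[ℝ] (Fin (Module.finrank ℝ F) → ℝ) :=
    ContinuousLinearEquiv.ofFinrankEq (Module.finrank_fin_fun ℝ).symm
  let e₂ := (e₁.arrowCongr (1 : F' ≃L[ℝ] F')).trans (ContinuousLinearEquiv.piRing _)
  rw [← Function.id_comp φ, ← e₂.symm_comp_self]
  exact e₂.symm.contDiff.contMDiff.contMDiffAt.comp x (contMDiffAt_pi_space.2 fun i ↦ h _)

section Cutoff

variable [ContMDiffVectorBundle ∞ F E (𝓡 m)]
  (t : Trivialization F (TotalSpace.proj : TotalSpace F E → M)) [MemTrivializationAtlas t]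
  {ψ : SmoothFun m M}

theorem contMDiff_smul_symmL (hψ : tsupport ψ ⊆ t.baseSet) (w : F) :
    ContMDiff (𝓡 m) ((𝓡 m).prod 𝓘(ℝ, F)) ∞ fun y ↦ TotalSpace.mk' F y (ψ y • t.symmL ℝ y w) := by
  refine ψ.contMDiff.contMDiffOn.smul_section_of_tsupport t.open_baseSet hψ
    (t.contMDiffOn_section_baseSet_iff.2 ((contMDiffOn_const (c := w)).congr fun y hy ↦ ?_))
  rw [← t.continuousLinearMapAt_apply_of_mem (R := ℝ) hy, t.continuousLinearMapAt_symmL hy]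

theorem contMDiff_smul_continuousLinearMapAt (hψ : tsupport ψ ⊆ t.baseSet) (a : F →L[ℝ] ℝ)
    (X : Cₛ^∞⟮𝓡 m; F, E⟯) : ContMDiff (𝓡 m) 𝓘(ℝ, ℝ) ∞
      fun y ↦ ψ y • a (t.continuousLinearMapAt ℝ y (X y)) := by
  have h : ContMDiffOn (𝓡 m) 𝓘(ℝ, ℝ) ∞
      (fun y ↦ a (t.continuousLinearMapAt ℝ y (X y))) t.baseSet := by
    refine (a.contMDiff.comp_contMDiffOn
      (t.contMDiffOn_section_baseSet_iff.1 X.contMDiff.contMDiffOn)).congr fun y hy ↦ ?_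
    rw [t.continuousLinearMapAt_apply_of_mem (R := ℝ) hy, Function.comp_apply]
  exact fun y ↦ (contMDiffAt_section (E := fun _ : M ↦ ℝ) _).1 <|
    ψ.contMDiff.contMDiffOn.smul_section_of_tsupport (V := fun _ : M ↦ ℝ) t.open_baseSet hψ
      (fun z hz ↦ contMDiffWithinAt_section.2 (h z hz)) y

end Cutoff

variable [IsManifold (𝓡 m) ∞ M] [T2Space M]

theorem exists_smoothFun_cutoff (x : M) {s : Set M} (hs : s ∈ 𝓝 x) :
    ∃ ψ : SmoothFun m M, (∀ᶠ y in 𝓝 x, ψ y = 1) ∧ tsupport ψ ⊆ s := by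
  obtain ⟨ψ, hψ, -⟩ := (SmoothBumpFunction.nhds_basis_support (I := 𝓡 m) hs).mem_iff.1 hs
  exact ⟨⟨ψ, ψ.contMDiff⟩, ψ.eventuallyEq_one, hψ⟩

variable [FiniteDimensional ℝ F] [ContMDiffVectorBundle ∞ F E (𝓡 m)]

theorem contMDiff_hom_of_apply [∀ x, IsTopologicalAddGroup (E' x)] [∀ x, ContinuousSMul ℝ (E' x)]
    (T : ∀ x, E x →L[ℝ] E' x)
    (hT : ∀ X : Cₛ^∞⟮𝓡 m; F, E⟯, ContMDiff (𝓡 m) ((𝓡 m).prod 𝓘(ℝ, F')) ∞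
      fun x ↦ TotalSpace.mk' F' x (T x (X x))) :
    ContMDiff (𝓡 m) ((𝓡 m).prod 𝓘(ℝ, F →L[ℝ] F')) ∞
      fun x ↦ TotalSpace.mk' (F →L[ℝ] F') (E := fun x ↦ E x →L[ℝ] E' x) x (T x) := by
  intro x
  refine (contMDiffAt_hom_bundle _).2 ⟨contMDiffAt_id, contMDiffAt_clm_of_apply fun w ↦ ?_⟩
  set t := trivializationAt F E x
  set t' := trivializationAt F' E' x
  have ht := t.open_baseSet.mem_nhds (FiberBundle.mem_baseSet_trivializationAt F E x)
  have ht' := t'.open_baseSet.mem_nhds (FiberBundle.mem_baseSet_trivializationAt F' E' x)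
  obtain ⟨ψ, hψ, hsupp⟩ := exists_smoothFun_cutoff (m := m) x ht
  let X : Cₛ^∞⟮𝓡 m; F, E⟯ := ⟨_, contMDiff_smul_symmL t hsupp w⟩
  refine ((contMDiffAt_section _).1 (hT X x)).congr_of_eventuallyEq ?_
  filter_upwards [hψ, ht, ht'] with y hy hyt hyt'
  have hX : X y = t.symmL ℝ y w := (congrArg (· • t.symmL ℝ y w) hy).trans (one_smul _ _)
  rw [hX, ContinuousLinearMap.inCoordinates_eq hyt hyt']
  simp [t, hyt]

/-- The section of the dual bundle given by linear forms on the fibres of `E` whose values on smooth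
sections are smooth. -/
noncomputable def dualSectionOfSmooth (c : ∀ x, E x →L[ℝ] ℝ)
    (hc : ∀ X : Cₛ^∞⟮𝓡 m; F, E⟯, ContMDiff (𝓡 m) 𝓘(ℝ, ℝ) ∞ fun x ↦ c x (X x)) :
    Cₛ^∞⟮𝓡 m; F →L[ℝ] ℝ, fun x ↦ E x →L[ℝ] ℝ⟯ where
  toFun := c
  contMDiff_toFun := contMDiff_hom_of_apply (F' := ℝ) (E' := fun _ ↦ ℝ) c fun X x ↦
    (contMDiffAt_section _).2 (hc X x)

variable (F E) in
theorem exists_cutoff_dual_frame (x : M) :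
    ∃ (ψ : SmoothFun m M) (e : Fin (Module.finrank ℝ F) → Cₛ^∞⟮𝓡 m; F, E⟯)
      (ε : Fin (Module.finrank ℝ F) → Cₛ^∞⟮𝓡 m; F →L[ℝ] ℝ, fun x ↦ E x →L[ℝ] ℝ⟯),
      (∀ᶠ y in 𝓝 x, ψ y = 1) ∧ ∀ y (v : E y), ψ y • v = ∑ i, ε i y v • e i y := by
  set t := trivializationAt F E x
  set b := Module.finBasis ℝ F
  obtain ⟨ψ, hψ, hsupp⟩ := exists_smoothFun_cutoff (m := m) x
    (t.open_baseSet.mem_nhds (FiberBundle.mem_baseSet_trivializationAt F E x))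
  let coord i : F →L[ℝ] ℝ := LinearMap.toContinuousLinearMap (b.coord i)
  let e i : Cₛ^∞⟮𝓡 m; F, E⟯ := ⟨_, contMDiff_smul_symmL t hsupp (b i)⟩
  let ε i := dualSectionOfSmooth (m := m)
    (fun y ↦ ψ y • (coord i).comp (t.continuousLinearMapAt ℝ y))
    (contMDiff_smul_continuousLinearMapAt t hsupp (coord i))
  refine ⟨ψ * ψ, e, ε, ?_, fun y v ↦ ?_⟩
  · filter_upwards [hψ] with y hy
    simp [hy]
  by_cases hy : y ∈ t.baseSet
  · have hv : ∑ i, coord i (t.continuousLinearMapAt ℝ y v) • t.symmL ℝ y (b i) = v := by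
      simp only [← map_smul, ← map_sum]
      exact (congrArg _ (b.sum_repr _)).trans (t.symmL_continuousLinearMapAt hy v)
    calc (ψ y * ψ y) • v
        = (ψ y * ψ y) • ∑ i, coord i (t.continuousLinearMapAt ℝ y v) • t.symmL ℝ y (b i) := by
          rw [hv]
      _ = ∑ i, ε i y v • e i y := by
          rw [Finset.smul_sum]
          refine Finset.sum_congr rfl fun i _ ↦ ?_
          change _ = (ψ y * coord i (t.continuousLinearMapAt ℝ y v)) • ψ y • t.symmL ℝ y (b i)
          module
  · have hψy : ψ y = 0 := image_eq_zero_of_notMem_tsupport fun h ↦ hy (hsupp h)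
    have he i : e i y = 0 :=
      (congrArg (· • t.symmL ℝ y (b i)) hψy).trans (zero_smul ℝ (t.symmL ℝ y (b i)))
    simp [hψy, he]

end Frames

section Duality

variable {m : ℕ} {M : Type*} [TopologicalSpace M] [ChartedSpace (EuclideanSpace ℝ (Fin m)) M]
  {F : Type*} [NormedAddCommGroup F] [NormedSpace ℝ F]
  {E : M → Type*} [∀ x, AddCommGroup (E x)] [∀ x, Module ℝ (E x)] [∀ x, TopologicalSpace (E x)]
  [TopologicalSpace (TotalSpace F E)] [FiberBundle F E] [VectorBundle ℝ F E]

theorem section_sum_apply {ι : Type*} (s : Finset ι) (X : ι → Cₛ^∞⟮𝓡 m; F, E⟯) (x : M) :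
    (∑ i ∈ s, X i) x = ∑ i ∈ s, X i x :=
  (congrFun (map_sum (ContMDiffSection.coeAddHom (𝓡 m) F ∞ E) X s) x).trans (Finset.sum_apply _ _ _)

theorem mulSection_apply (f : SmoothFun m M) (X : Cₛ^∞⟮𝓡 m; F, E⟯) (x : M) :
    mulSection f X x = f x • X x := rfl

theorem pairing_add_left (θ η : Cₛ^∞⟮𝓡 m; F →L[ℝ] ℝ, fun x ↦ E x →L[ℝ] ℝ⟯)
    (X : Cₛ^∞⟮𝓡 m; F, E⟯) : pairing (θ + η) X = pairing θ X + pairing η X := rfl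

theorem pairing_neg_left (θ : Cₛ^∞⟮𝓡 m; F →L[ℝ] ℝ, fun x ↦ E x →L[ℝ] ℝ⟯)
    (X : Cₛ^∞⟮𝓡 m; F, E⟯) : pairing (-θ) X = -pairing θ X := rfl

theorem pairing_mulSection_left (f : SmoothFun m M)
    (θ : Cₛ^∞⟮𝓡 m; F →L[ℝ] ℝ, fun x ↦ E x →L[ℝ] ℝ⟯) (X : Cₛ^∞⟮𝓡 m; F, E⟯) :
    pairing (mulSection f θ) X = f * pairing θ X := rfl

theorem pairing_add_right (θ : Cₛ^∞⟮𝓡 m; F →L[ℝ] ℝ, fun x ↦ E x →L[ℝ] ℝ⟯)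
    (X Y : Cₛ^∞⟮𝓡 m; F, E⟯) : pairing θ (X + Y) = pairing θ X + pairing θ Y := by
  ext x
  exact map_add (θ x) _ _

theorem pairing_neg_right (θ : Cₛ^∞⟮𝓡 m; F →L[ℝ] ℝ, fun x ↦ E x →L[ℝ] ℝ⟯)
    (X : Cₛ^∞⟮𝓡 m; F, E⟯) : pairing θ (-X) = -pairing θ X := by
  ext x
  exact map_neg (θ x) _

theorem pairing_mulSection_right (f : SmoothFun m M)
    (θ : Cₛ^∞⟮𝓡 m; F →L[ℝ] ℝ, fun x ↦ E x →L[ℝ] ℝ⟯) (X : Cₛ^∞⟮𝓡 m; F, E⟯) :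
    pairing θ (mulSection f X) = f * pairing θ X := by
  ext x
  exact map_smul (θ x) _ _

theorem mulSection_eq_sum_dual_frame {ι : Type*} [Fintype ι] {ψ : SmoothFun m M}
    {e : ι → Cₛ^∞⟮𝓡 m; F, E⟯} {ε : ι → Cₛ^∞⟮𝓡 m; F →L[ℝ] ℝ, fun x ↦ E x →L[ℝ] ℝ⟯}
    (h : ∀ y (v : E y), ψ y • v = ∑ i, ε i y v • e i y)
    (θ : Cₛ^∞⟮𝓡 m; F →L[ℝ] ℝ, fun x ↦ E x →L[ℝ] ℝ⟯) :
    mulSection ψ θ = ∑ i, mulSection (pairing θ (e i)) (ε i) := by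
  ext y v
  calc ψ y * θ y v = θ y (ψ y • v) := (map_smul (θ y) _ _).symm
    _ = ∑ i, θ y (e i y) * ε i y v := by simp [h, mul_comm]
    _ = (∑ i, mulSection (pairing θ (e i)) (ε i)) y v := by
        rw [section_sum_apply, sum_apply]
        rfl

variable [IsManifold (𝓡 m) ∞ M] [T2Space M] [FiniteDimensional ℝ F]
  [ContMDiffVectorBundle ∞ F E (𝓡 m)]

variable (F) in
theorem exists_section_apply_eq (x : M) (v : E x) : ∃ X : Cₛ^∞⟮𝓡 m; F, E⟯, X x = v := by
  obtain ⟨ψ, e, ε, hψ, h⟩ := exists_cutoff_dual_frame (m := m) F E x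
  refine ⟨∑ i, ε i x v • e i, ?_⟩
  rw [section_sum_apply]
  exact (h x v).symm.trans (by rw [hψ.self_of_nhds, one_smul])

variable (F) in
theorem exists_dualSection_apply_eq (x : M) (α : E x →L[ℝ] ℝ) :
    ∃ θ : Cₛ^∞⟮𝓡 m; F →L[ℝ] ℝ, fun x ↦ E x →L[ℝ] ℝ⟯, θ x = α := by
  obtain ⟨ψ, e, ε, hψ, h⟩ := exists_cutoff_dual_frame (m := m) F E x
  refine ⟨∑ i, α (e i x) • ε i, ContinuousLinearMap.ext fun v ↦ ?_⟩
  have hv : v = ∑ i, ε i x v • e i x := by rw [← h, hψ.self_of_nhds, one_smul]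
  calc (∑ i, α (e i x) • ε i : Cₛ^∞⟮𝓡 m; F →L[ℝ] ℝ, fun x ↦ E x →L[ℝ] ℝ⟯) x v
      = ∑ i, ε i x v * α (e i x) := by
        simp [section_sum_apply, mul_comm]
    _ = α v := by
        conv_rhs => rw [hv]
        simp only [map_sum, map_smul, smul_eq_mul]

theorem section_ext_of_pairing {X Y : Cₛ^∞⟮𝓡 m; F, E⟯}
    (h : ∀ θ : Cₛ^∞⟮𝓡 m; F →L[ℝ] ℝ, fun x ↦ E x →L[ℝ] ℝ⟯, pairing θ X = pairing θ Y) : X = Y := by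
  ext x
  refine dual_separates F x fun α ↦ ?_
  obtain ⟨θ, rfl⟩ := exists_dualSection_apply_eq (m := m) F x α
  exact DFunLike.congr_fun (h θ) x

theorem dualSection_ext_of_pairing {θ η : Cₛ^∞⟮𝓡 m; F →L[ℝ] ℝ, fun x ↦ E x →L[ℝ] ℝ⟯}
    (h : ∀ X : Cₛ^∞⟮𝓡 m; F, E⟯, pairing θ X = pairing η X) : θ = η := by
  ext x v
  obtain ⟨X, rfl⟩ := exists_section_apply_eq (m := m) F x v
  exact DFunLike.congr_fun (h X) x

theorem exists_eventually_pairing_eq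
    {φ : Cₛ^∞⟮𝓡 m; F →L[ℝ] ℝ, fun x ↦ E x →L[ℝ] ℝ⟯ → SmoothFun m M}
    (hadd : ∀ θ η, φ (θ + η) = φ θ + φ η) (hmul : ∀ f θ, φ (mulSection f θ) = f * φ θ) (x : M) :
    ∃ X : Cₛ^∞⟮𝓡 m; F, E⟯, ∀ᶠ y in 𝓝 x, ∀ θ, pairing θ X y = φ θ y := by
  obtain ⟨ψ, e, ε, hψ, h⟩ := exists_cutoff_dual_frame (m := m) F E x
  refine ⟨∑ i, mulSection (φ (ε i)) (e i), hψ.mono fun y hy θ ↦ ?_⟩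
  have hX : pairing θ (∑ i, mulSection (φ (ε i)) (e i)) = ψ * φ θ :=
    calc pairing θ (∑ i, mulSection (φ (ε i)) (e i))
        = ∑ i, φ (ε i) * pairing θ (e i) := by
          simp only [← pairing_mulSection_right]
          exact map_sum (AddMonoidHom.mk' (pairing θ) (pairing_add_right θ)) _ _
      _ = ∑ i, φ (mulSection (pairing θ (e i)) (ε i)) := by simp only [hmul, mul_comm]
      _ = φ (mulSection ψ θ) := by
          rw [mulSection_eq_sum_dual_frame h]
          exact (map_sum (AddMonoidHom.mk' φ hadd) _ _).symm
      _ = ψ * φ θ := hmul ψ θ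
  calc pairing θ (∑ i, mulSection (φ (ε i)) (e i)) y = ψ y * φ θ y := DFunLike.congr_fun hX y
    _ = φ θ y := by rw [hy, one_mul]

theorem exists_pairing_eq {φ : Cₛ^∞⟮𝓡 m; F →L[ℝ] ℝ, fun x ↦ E x →L[ℝ] ℝ⟯ → SmoothFun m M}
    (hadd : ∀ θ η, φ (θ + η) = φ θ + φ η) (hmul : ∀ f θ, φ (mulSection f θ) = f * φ θ) :
    ∃ X : Cₛ^∞⟮𝓡 m; F, E⟯, ∀ θ, pairing θ X = φ θ := by
  choose X hX using exists_eventually_pairing_eq hadd hmul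
  have hglue x : ∀ᶠ y in 𝓝 x, X y y = X x y := (hX x).mono fun y hy ↦ by
    refine dual_separates F y fun α ↦ ?_
    obtain ⟨θ, rfl⟩ := exists_dualSection_apply_eq (m := m) F y α
    exact ((hX y).self_of_nhds θ).trans (hy θ).symm
  refine ⟨⟨fun x ↦ X x x, fun x ↦ ((X x).contMDiff x).congr_of_eventuallyEq ?_⟩, fun θ ↦ ?_⟩
  · exact (hglue x).mono fun y hy ↦ congrArg _ hy
  · ext x
    exact (hX x).self_of_nhds θ

end Duality

section Representer

theorem Cochain.representer_eq {R N N' : Type*} [AddCommGroup N] {pair : N' → N → R} {φ : N' → R}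
    {X : N} (hX : ∀ θ, pair θ X = φ θ) (hinj : ∀ Y, (∀ θ, pair θ Y = pair θ X) → Y = X) :
    Cochain.representer pair φ = X := by
  have h : ∃ X, ∀ θ, pair θ X = φ θ := ⟨X, hX⟩
  rw [Cochain.representer, dif_pos h]
  exact hinj _ fun θ ↦ (h.choose_spec θ).trans (hX θ).symm

theorem Cochain.pair_representer {R N N' : Type*} [AddCommGroup N] {pair : N' → N → R}
    {φ : N' → R} (h : ∃ X, ∀ θ, pair θ X = φ θ) (θ : N') :
    pair θ (Cochain.representer pair φ) = φ θ := by
  rw [Cochain.representer, dif_pos h]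
  exact h.choose_spec θ

variable {m : ℕ} {M : Type*} [TopologicalSpace M] [ChartedSpace (EuclideanSpace ℝ (Fin m)) M]
  [IsManifold (𝓡 m) ∞ M] [T2Space M]
  {F : Type*} [NormedAddCommGroup F] [NormedSpace ℝ F] [FiniteDimensional ℝ F]
  {E : M → Type*} [∀ x, AddCommGroup (E x)] [∀ x, Module ℝ (E x)] [∀ x, TopologicalSpace (E x)]
  [TopologicalSpace (TotalSpace F E)] [FiberBundle F E] [VectorBundle ℝ F E]
  [ContMDiffVectorBundle ∞ F E (𝓡 m)]

theorem representer_pairing_eq {X : Cₛ^∞⟮𝓡 m; F, E⟯}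
    {φ : Cₛ^∞⟮𝓡 m; F →L[ℝ] ℝ, fun x ↦ E x →L[ℝ] ℝ⟯ → SmoothFun m M}
    (hX : ∀ θ, pairing θ X = φ θ) : Cochain.representer pairing φ = X :=
  Cochain.representer_eq hX fun _ ↦ section_ext_of_pairing

theorem representer_pairing'_eq {θ : Cₛ^∞⟮𝓡 m; F →L[ℝ] ℝ, fun x ↦ E x →L[ℝ] ℝ⟯}
    {φ : Cₛ^∞⟮𝓡 m; F, E⟯ → SmoothFun m M}
    (hθ : ∀ X, pairing θ X = φ X) : Cochain.representer pairing' φ = θ :=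
  Cochain.representer_eq hθ fun _ ↦ dualSection_ext_of_pairing

end Representer

section VectorFields

variable {m : ℕ} {M : Type*} [TopologicalSpace M] [ChartedSpace (EuclideanSpace ℝ (Fin m)) M]

theorem SmoothFun.mdifferentiableAt (f : SmoothFun m M) (x : M) :
    MDifferentiableAt (𝓡 m) 𝓘(ℝ, ℝ) f x :=
  (f.contMDiff x).mdifferentiableAt (by simp)

variable [IsManifold (𝓡 m) ∞ M]

/-- The derivation `f ↦ X(f)` of the algebra of smooth functions given by a vector field `X`. -/
noncomputable def VectorFields.toDerivation (X : VectorFields m M) :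
    Derivation ℝ (SmoothFun m M) (SmoothFun m M) :=
  Derivation.mk'
    { toFun := X.act
      map_add' := fun f g ↦ by
        ext x
        change mfderiv (𝓡 m) 𝓘(ℝ, ℝ) (⇑f + ⇑g) x (X x) = _
        rw [mfderiv_add (f.mdifferentiableAt x) (g.mdifferentiableAt x)]
        rfl
      map_smul' := fun a f ↦ by
        ext x
        change mfderiv (𝓡 m) 𝓘(ℝ, ℝ) (a • ⇑f) x (X x) = _
        rw [const_smul_mfderiv (f.mdifferentiableAt x)]
        rfl }
    fun f g ↦ by
      ext x
      change mfderiv (𝓡 m) 𝓘(ℝ, ℝ) (⇑f * ⇑g) x (X x) = _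
      rw [((f.mdifferentiableAt x).hasMFDerivAt.mul (g.mdifferentiableAt x).hasMFDerivAt).mfderiv]
      rfl

theorem VectorFields.smul_sub_act (c : ℝ) (X Y : VectorFields m M) (f : SmoothFun m M) :
    (c • (X - Y)).act f = c • (X.act f - Y.act f) := by
  ext x
  change differential f x (c • (X x - Y x)) = _
  rw [map_smul, map_sub]
  rfl

theorem VectorFields.bracket_neg_left (X Y : VectorFields m M) :
    VectorFields.bracket (-X) Y = -VectorFields.bracket X Y := by
  have : IsManifold (𝓡 m) (minSmoothness ℝ 2) M := by
    rw [minSmoothness_of_isRCLikeNormedField]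
    exact IsManifold.of_le (n := ∞) (WithTop.coe_le_coe.2 le_top)
  ext x : 1
  have h := mlieBracket_const_smul_left (I := 𝓡 m) (c := (-1 : ℝ)) (W := Y)
    ((X.contMDiff x).mdifferentiableAt (by simp))
  rw [neg_one_smul, neg_one_smul] at h
  exact h

variable [T2Space M]

theorem exists_differential_eq (x : M) (α : TangentSpace (𝓡 m) x →L[ℝ] ℝ) :
    ∃ f : SmoothFun m M, differential f x = α := by
  obtain ⟨ψ⟩ : Nonempty (SmoothBumpFunction (𝓡 m) x) := inferInstance
  let B := mfderiv (𝓡 m) 𝓘(ℝ, EuclideanSpace ℝ (Fin m)) (extChartAt (𝓡 m) x) x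
  have hB : B.IsInvertible := isInvertible_mfderiv_extChartAt (mem_extChartAt_source x)
  let G : EuclideanSpace ℝ (Fin m) →L[ℝ] ℝ := α.comp B.inverse
  have hψ : ContMDiff (𝓡 m) 𝓘(ℝ, ℝ) ∞ fun y ↦ ψ y • G (extChartAt (𝓡 m) x y) :=
    ψ.contMDiff_smul (G.contMDiff.comp_contMDiffOn contMDiffOn_extChartAt)
  have hlocal : (fun y ↦ ψ y • G (extChartAt (𝓡 m) x y)) =ᶠ[𝓝 x] G ∘ extChartAt (𝓡 m) x :=
    ψ.eventuallyEq_one.mono fun y hy ↦ (congrArg (· • _) hy).trans (one_smul ℝ _)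
  have hchain : mfderiv (𝓡 m) 𝓘(ℝ, ℝ) (G ∘ extChartAt (𝓡 m) x) x = G.comp B := by
    rw [mfderiv_comp x G.mdifferentiableAt
      (mdifferentiableAt_extChartAt (mem_chart_source _ x)), G.mfderiv_eq]
    rfl
  refine ⟨⟨_, hψ⟩, (hlocal.mfderiv_eq.trans hchain).trans ?_⟩
  ext v
  exact congrArg α (hB.inverse_apply_eq.2 rfl)

theorem VectorFields.ext_of_act {X Y : VectorFields m M} (h : ∀ f, X.act f = Y.act f) : X = Y := by
  ext x : 1
  refine dual_separates (EuclideanSpace ℝ (Fin m)) (E := fun x : M ↦ TangentSpace (𝓡 m) x) x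
    fun α ↦ ?_
  obtain ⟨f, rfl⟩ := exists_differential_eq x α
  exact DFunLike.congr_fun (h f) x

end VectorFields

namespace LieAlgebroid

variable {m : ℕ} {M : Type*} [TopologicalSpace M] [ChartedSpace (EuclideanSpace ℝ (Fin m)) M]
  [IsManifold (𝓡 m) ∞ M]
  {F : Type*} [NormedAddCommGroup F] [NormedSpace ℝ F]
  {E : M → Type*} [∀ x, AddCommGroup (E x)] [∀ x, Module ℝ (E x)] [∀ x, TopologicalSpace (E x)]
  [TopologicalSpace (TotalSpace F E)] [FiberBundle F E] [VectorBundle ℝ F E]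
  (L : LieAlgebroid m F E)

theorem br_neg_swap (X Y : Cₛ^∞⟮𝓡 m; F, E⟯) : L.br X Y = -L.br Y X := by
  have h := L.bracket_self (X + Y)
  simp only [map_add, LinearMap.add_apply, L.bracket_self, zero_add, add_zero] at h
  exact eq_neg_of_add_eq_zero_right h

theorem br_add_left (X Y Z : Cₛ^∞⟮𝓡 m; F, E⟯) : L.br (X + Y) Z = L.br X Z + L.br Y Z :=
  LinearMap.map_add₂ L.bracket X Y Z

theorem br_add_right (X Y Z : Cₛ^∞⟮𝓡 m; F, E⟯) : L.br X (Y + Z) = L.br X Y + L.br X Z :=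
  map_add (L.bracket X) Y Z

theorem br_mulSection (f : SmoothFun m M) (X Y : Cₛ^∞⟮𝓡 m; F, E⟯) :
    L.br X (mulSection f Y) = mulSection (L.act X f) Y + mulSection f (L.br X Y) := by
  ext x
  exact L.leibniz X Y f x

theorem act_add_left (X Y : Cₛ^∞⟮𝓡 m; F, E⟯) (f : SmoothFun m M) :
    L.act (X + Y) f = L.act X f + L.act Y f := by
  ext x
  exact map_add ((differential f x).comp (L.anchor x)) (X x) (Y x)

theorem act_mulSection (g : SmoothFun m M) (X : Cₛ^∞⟮𝓡 m; F, E⟯) (f : SmoothFun m M) :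
    L.act (mulSection g X) f = g * L.act X f := by
  ext x
  exact map_smul ((differential f x).comp (L.anchor x)) (g x) (X x)

theorem act_neg (X : Cₛ^∞⟮𝓡 m; F, E⟯) (f : SmoothFun m M) : L.act X (-f) = -L.act X f :=
  map_neg (L.rho X).toDerivation f

theorem act_add (X : Cₛ^∞⟮𝓡 m; F, E⟯) (f g : SmoothFun m M) :
    L.act X (f + g) = L.act X f + L.act X g :=
  map_add (L.rho X).toDerivation f g

theorem act_mul (X : Cₛ^∞⟮𝓡 m; F, E⟯) (f g : SmoothFun m M) :
    L.act X (f * g) = f * L.act X g + g * L.act X f :=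
  (L.rho X).toDerivation.leibniz f g

variable [T2Space M] [FiniteDimensional ℝ F] [ContMDiffVectorBundle ∞ F E (𝓡 m)]

-- Expanding the Jacobi identity for `X`, `Y`, `f Z` by the Leibniz rule, the terms without
-- derivatives of `f` cancel and the commutator identity remains as the coefficient of `Z`.
theorem act_br (X Y : Cₛ^∞⟮𝓡 m; F, E⟯) (f : SmoothFun m M) :
    L.act (L.br X Y) f = L.act X (L.act Y f) - L.act Y (L.act X f) := by
  ext x
  change _ = L.act X (L.act Y f) x - L.act Y (L.act X f) x
  obtain hx | hx := subsingleton_or_nontrivial (E x)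
  · have hact W (g : SmoothFun m M) : L.act W g x = 0 := by
      change differential g x (L.anchor x (W x)) = 0
      rw [Subsingleton.elim (W x) 0, map_zero, map_zero]
    rw [hact, hact, hact, sub_zero]
  obtain ⟨v, hv⟩ := exists_ne (0 : E x)
  obtain ⟨Z, rfl⟩ := exists_section_apply_eq (m := m) F x v
  have hjacobi W : L.br X (L.br Y W) = L.br (L.br X Y) W + L.br Y (L.br X W) := L.jacobi X Y W
  have hfZ := DFunLike.congr_fun (hjacobi (mulSection f Z)) x
  have hZ := DFunLike.congr_fun (hjacobi Z) x
  simp only [br_mulSection, br_add_right, ContMDiffSection.coe_add, Pi.add_apply, mulSection_apply]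
    at hfZ hZ
  have hcoeff : (L.act (L.br X Y) f x - (L.act X (L.act Y f) x - L.act Y (L.act X f) x)) • Z x
      = 0 := by
    linear_combination (norm := module) f x • hZ - hfZ
  exact sub_eq_zero.1 ((smul_eq_zero.1 hcoeff).resolve_right hv)

/-- The differential of a function with respect to a Lie algebroid structure on `E`, a section of
the dual bundle: `⟨df, X⟩ = ρ(X) f`. -/
protected noncomputable def differential (f : SmoothFun m M) :
    Cₛ^∞⟮𝓡 m; F →L[ℝ] ℝ, fun x ↦ E x →L[ℝ] ℝ⟯ :=
  dualSectionOfSmooth (fun x ↦ (differential f x).comp (L.anchor x)) fun X ↦ (L.act X f).contMDiff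

@[simp]
theorem pairing_differential (f : SmoothFun m M) (X : Cₛ^∞⟮𝓡 m; F, E⟯) :
    pairing (L.differential f) X = L.act X f := rfl

variable (L' : LieAlgebroid m (F →L[ℝ] ℝ) fun x ↦ E x →L[ℝ] ℝ)

/-- The transpose `(ρ⁎)* : T*M → E` of the anchor of a Lie algebroid structure on the dual bundle,
on sections: `⟨η, (ρ⁎)* α⟩ = ⟨α, ρ⁎(η)⟩`. -/
noncomputable def anchorTransposeSection (α : OneForms m M) : Cₛ^∞⟮𝓡 m; F, E⟯ :=
  Cochain.representer pairing fun η ↦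
    pairing (E := fun x : M ↦ TangentSpace (𝓡 m) x) α (L'.rho η)

theorem pairing_anchorTransposeSection (α : OneForms m M)
    (η : Cₛ^∞⟮𝓡 m; F →L[ℝ] ℝ, fun x ↦ E x →L[ℝ] ℝ⟯) :
    pairing η (L'.anchorTransposeSection α) =
      pairing (E := fun x : M ↦ TangentSpace (𝓡 m) x) α (L'.rho η) := by
  refine Cochain.pair_representer (exists_pairing_eq (fun θ η ↦ ?_) fun g θ ↦ ?_) η
  · ext x
    exact map_add ((α x).comp (L'.anchor x)) (θ x) (η x)
  · ext x
    exact map_smul ((α x).comp (L'.anchor x)) (g x) (θ x)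

/-- The differential `d⁎f` of a function with respect to a Lie algebroid structure on the dual
bundle, as a section of the bundle itself rather than of its bidual: `⟨η, d⁎f⟩ = ρ⁎(η) f`. -/
noncomputable def dualDifferential (f : SmoothFun m M) : Cₛ^∞⟮𝓡 m; F, E⟯ :=
  L'.anchorTransposeSection (differential f)

@[simp]
theorem pairing_dualDifferential (f : SmoothFun m M)
    (η : Cₛ^∞⟮𝓡 m; F →L[ℝ] ℝ, fun x ↦ E x →L[ℝ] ℝ⟯) :
    pairing η (L'.dualDifferential f) = L'.act η f :=
  L'.pairing_anchorTransposeSection (differential f) η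

end LieAlgebroid

namespace Cochain

variable {R N N' : Type*} [CommRing R]

theorem d_zero_apply (act : N → R → R) (br : N → N → N) (α : (Fin 0 → N) → R) (X : Fin 1 → N) :
    d act br α X = act (X 0) (α Fin.elim0) := by
  simp [d, Subsingleton.elim _ (Fin.elim0 : Fin 0 → N)]

theorem d_one_apply (act : N → R → R) (br : N → N → N) (α : (Fin 1 → N) → R) (X : Fin 2 → N) :
    d act br α X = act (X 0) (α fun _ ↦ X 1) - act (X 1) (α fun _ ↦ X 0) -
      α fun _ ↦ br (X 0) (X 1) := by
  have h₀ : (fun i : Fin 1 ↦ X ((0 : Fin 2).succAbove i)) = fun _ ↦ X 1 := by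
    funext i; fin_cases i; rfl
  have h₁ : (fun i : Fin 1 ↦ X ((1 : Fin 2).succAbove i)) = fun _ ↦ X 0 := by
    funext i; fin_cases i; rfl
  have hbr : Function.update (fun _ : Fin 1 ↦ X 0) 0 (br (X 0) (X 1)) = fun _ ↦ br (X 0) (X 1) := by
    funext i; fin_cases i; rfl
  rw [d, Fin.sum_univ_two, Fin.sum_univ_two, Fin.sum_univ_one, Fin.sum_univ_one, h₀, h₁]
  simp [hbr, sub_eq_add_neg]

variable [Algebra ℝ R] [AddCommGroup N] [AddCommGroup N']

theorem slice_zero_self {n : ℕ} (θ : Fin n → N') : slice θ 0 n = θ := by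
  funext i
  simp [slice, entry]

theorem derivTerm_apply_of_subsingleton (act : N → R → R) (pair : N' → N → R) {p l n : ℕ}
    [Subsingleton (Equiv.Perm (Fin n))] (hp : p.factorial = 1) (hl : l.factorial = 1)
    (P : (Fin (p + 1) → N') → R) (Q : (Fin l → N') → R) (θ : Fin n → N') :
    derivTerm act pair n P Q θ = act (sharp pair P (slice θ 0 p)) (Q (slice θ p l)) := by
  rw [derivTerm, Fintype.sum_subsingleton _ 1]
  simp [hp, hl]

theorem contractTerm_apply_of_subsingleton (act : N → R → R) (br : N → N → N)
    (pair : N' → N → R) {p q n : ℕ}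
    [Subsingleton (Equiv.Perm (Fin n))] (hp : p.factorial = 1) (hq : q.factorial = 1)
    (P : (Fin (p + 1) → N') → R) (Q : (Fin (q + 1) → N') → R) (θ : Fin n → N') :
    contractTerm act br pair n P Q θ = dTwo act br pair (entry θ 0)
      (sharp pair P (slice θ 1 p)) (sharp pair Q (slice θ (1 + p) q)) := by
  rw [contractTerm, Fintype.sum_subsingleton _ 1]
  simp [hp, hq]

theorem schouten_zero_two_apply (act : N → R → R) (br : N → N → N) (pair : N' → N → R)
    (P : (Fin 0 → N') → R) (Q : (Fin 2 → N') → R) (θ : Fin 1 → N') :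
    schouten act br pair 1 P Q θ = -act (sharp pair Q θ) (P Fin.elim0) := by
  simp [schouten, derivTerm_apply_of_subsingleton _ _ Nat.factorial_one Nat.factorial_zero,
    slice_zero_self, Subsingleton.elim _ (Fin.elim0 : Fin 0 → N')]

end Cochain

namespace FormField

variable {m : ℕ} {M : Type*} [TopologicalSpace M] [ChartedSpace (EuclideanSpace ℝ (Fin m)) M]
  {F : Type*} [NormedAddCommGroup F] [NormedSpace ℝ F]
  {E : M → Type*} [∀ x, AddCommGroup (E x)] [∀ x, Module ℝ (E x)] [∀ x, TopologicalSpace (E x)]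
  [TopologicalSpace (TotalSpace F E)] [FiberBundle F E]

variable (F E) in
/-- A smooth function as a form of degree `0`. -/
noncomputable def ofFun (f : SmoothFun m M) : FormField m F E 0 where
  toFun x := AlternatingMap.constOfIsEmpty ℝ (E x) (Fin 0) (f x)
  smooth _ := f.contMDiff

@[simp]
theorem ofFun_eval (f : SmoothFun m M) (X : Fin 0 → Cₛ^∞⟮𝓡 m; F, E⟯) :
    (ofFun F E f).eval X = f := rfl

variable [VectorBundle ℝ F E]

/-- A section of `E` as a form of degree `1` on the dual bundle. -/
noncomputable def ofSection (X : Cₛ^∞⟮𝓡 m; F, E⟯) :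
    FormField m (F →L[ℝ] ℝ) (fun x ↦ E x →L[ℝ] ℝ) 1 where
  toFun x := AlternatingMap.ofSubsingleton ℝ (E x →L[ℝ] ℝ) ℝ (0 : Fin 1)
    { toFun := fun α ↦ α (X x), map_add' := fun _ _ ↦ rfl, map_smul' := fun _ _ ↦ rfl }
  smooth θ := (pairing (θ 0) X).contMDiff

@[simp]
theorem ofSection_eval (X : Cₛ^∞⟮𝓡 m; F, E⟯)
    (θ : Fin 1 → Cₛ^∞⟮𝓡 m; F →L[ℝ] ℝ, fun x ↦ E x →L[ℝ] ℝ⟯) :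
    (ofSection X).eval θ = pairing (θ 0) X := rfl

end FormField

section Bialgebroid

variable {m : ℕ} {M : Type*} [TopologicalSpace M] [ChartedSpace (EuclideanSpace ℝ (Fin m)) M]
  [IsManifold (𝓡 m) ∞ M] [T2Space M]
  {F : Type*} [NormedAddCommGroup F] [NormedSpace ℝ F] [FiniteDimensional ℝ F]
  {A : M → Type*} [∀ x, AddCommGroup (A x)] [∀ x, Module ℝ (A x)] [∀ x, TopologicalSpace (A x)]
  [TopologicalSpace (TotalSpace F A)] [FiberBundle F A] [VectorBundle ℝ F A]
  [ContMDiffVectorBundle ∞ F A (𝓡 m)]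

namespace Cochain

@[simp]
theorem sharp_ofSection (X : Cₛ^∞⟮𝓡 m; F, A⟯)
    (θ : Fin 0 → Cₛ^∞⟮𝓡 m; F →L[ℝ] ℝ, fun x ↦ A x →L[ℝ] ℝ⟯) :
    sharp pairing (FormField.ofSection X).eval θ = X :=
  representer_pairing_eq fun _ ↦ rfl

variable (L : LieAlgebroid m F A) (L' : LieAlgebroid m (F →L[ℝ] ℝ) fun x ↦ A x →L[ℝ] ℝ)

theorem d_ofFun (f : SmoothFun m M) :
    d L'.act L'.br (FormField.ofFun (F →L[ℝ] ℝ) (fun x ↦ A x →L[ℝ] ℝ) f).eval =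
      (FormField.ofSection (L'.dualDifferential f)).eval := by
  funext η
  rw [d_zero_apply, FormField.ofSection_eval, L'.pairing_dualDifferential, FormField.ofFun_eval]

theorem pairing_sharp_d_ofSection (X : Cₛ^∞⟮𝓡 m; F, A⟯)
    (ζ η : Cₛ^∞⟮𝓡 m; F →L[ℝ] ℝ, fun x ↦ A x →L[ℝ] ℝ⟯) :
    pairing ζ (sharp pairing (d L'.act L'.br (FormField.ofSection X).eval) fun _ : Fin 1 ↦ η) =
      dTwo L'.act L'.br pairing' X ζ η := by
  have hcons ζ : d L'.act L'.br (FormField.ofSection X).eval (Fin.cons ζ fun _ : Fin 1 ↦ η) =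
      dTwo L'.act L'.br pairing' X ζ η := d_one_apply _ _ _ _
  refine (pair_representer (exists_pairing_eq (fun ζ ζ' ↦ ?_) fun g ζ ↦ ?_) ζ).trans (hcons ζ)
  · simp only [hcons, dTwo, pairing', L'.act_add_left, pairing_add_left, L'.act_add, L'.br_add_left]
    ring
  · simp only [hcons, dTwo, pairing', L'.act_mulSection, pairing_mulSection_left, L'.act_mul,
      L'.br_neg_swap _ η, L'.br_mulSection, pairing_neg_left, pairing_add_left]
    ring

theorem schouten_ofSection_ofFun (X : Cₛ^∞⟮𝓡 m; F, A⟯) (f : SmoothFun m M) :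
    schouten L.act L.br pairing 0 (FormField.ofSection X).eval
      (FormField.ofFun (F →L[ℝ] ℝ) (fun x ↦ A x →L[ℝ] ℝ) f).eval =
        (FormField.ofFun (F →L[ℝ] ℝ) (fun x ↦ A x →L[ℝ] ℝ) (L.act X f)).eval := by
  funext θ
  simp [schouten, derivTerm_apply_of_subsingleton _ _ Nat.factorial_zero Nat.factorial_zero]

theorem schouten_ofFun_ofSection (f : SmoothFun m M) (X : Cₛ^∞⟮𝓡 m; F, A⟯) :
    schouten L.act L.br pairing 0 (FormField.ofFun (F →L[ℝ] ℝ) (fun x ↦ A x →L[ℝ] ℝ) f).eval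
      (FormField.ofSection X).eval =
        (FormField.ofFun (F →L[ℝ] ℝ) (fun x ↦ A x →L[ℝ] ℝ) (-L.act X f)).eval := by
  funext θ
  simp [schouten, derivTerm_apply_of_subsingleton _ _ Nat.factorial_zero Nat.factorial_zero]

theorem schouten_ofSection_ofSection (X Y : Cₛ^∞⟮𝓡 m; F, A⟯) :
    schouten L.act L.br pairing 1 (FormField.ofSection X).eval (FormField.ofSection Y).eval =
      (FormField.ofSection (L.br X Y)).eval := by
  funext θ
  simp [schouten, derivTerm_apply_of_subsingleton _ _ Nat.factorial_zero Nat.factorial_one,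
    contractTerm_apply_of_subsingleton _ _ _ Nat.factorial_zero Nat.factorial_zero, dTwo,
    slice_zero_self, entry]

end Cochain

namespace IsLieBialgebroid

variable {L : LieAlgebroid m F A} {L' : LieAlgebroid m (F →L[ℝ] ℝ) fun x ↦ A x →L[ℝ] ℝ}

theorem act_dualDifferential_skew (h : IsLieBialgebroid L L') (f g : SmoothFun m M) :
    L.act (L'.dualDifferential f) g = -L.act (L'.dualDifferential g) f := by
  have hfg := congrFun (h.zero_zero (FormField.ofFun _ _ f) (FormField.ofFun _ _ g)) Fin.elim0
  rw [Cochain.d_ofFun, Cochain.d_ofFun, Cochain.schouten_ofSection_ofFun,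
    Cochain.schouten_ofFun_ofSection] at hfg
  exact eq_neg_of_add_eq_zero_left ((sub_neg_eq_add _ _).symm.trans hfg)

-- `[d⁎f, X] = -L_{df} X`, paired with `η`.
theorem pairing_br_dualDifferential (h : IsLieBialgebroid L L') (f : SmoothFun m M)
    (X : Cₛ^∞⟮𝓡 m; F, A⟯) (η : Cₛ^∞⟮𝓡 m; F →L[ℝ] ℝ, fun x ↦ A x →L[ℝ] ℝ⟯) :
    pairing η (L.br (L'.dualDifferential f) X) =
      pairing (L'.br (L.differential f) η) X - L'.act (L.differential f) (pairing η X) := by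
  set W := Cochain.sharp pairing (Cochain.d L'.act L'.br (FormField.ofSection X).eval)
    fun _ : Fin 1 ↦ η
  have hfX : -L'.act η (L.act X f) =
      pairing η (L.br (L'.dualDifferential f) X) + L.act W f := by
    have hd := congrFun (h.derivation 0 1 0 rfl (FormField.ofFun _ _ f) (FormField.ofSection X))
      fun _ ↦ η
    simpa [Cochain.schouten_ofFun_ofSection, Cochain.d_ofFun, Cochain.schouten_ofSection_ofSection,
      Cochain.schouten_zero_two_apply, L'.act_neg] using hd
  have hW : L.act W f = L'.act (L.differential f) (pairing η X) - L'.act η (L.act X f) -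
      pairing (L'.br (L.differential f) η) X :=
    Cochain.pairing_sharp_d_ofSection L' X (L.differential f) η
  linear_combination -hW - hfX

theorem act_differential (h : IsLieBialgebroid L L') (f g : SmoothFun m M) :
    L'.act (L.differential f) g = -L.act (L'.dualDifferential f) g := by
  rw [← L'.pairing_dualDifferential, L.pairing_differential, h.act_dualDifferential_skew]

theorem rho_differential (h : IsLieBialgebroid L L') (f : SmoothFun m M) :
    L'.rho (L.differential f) = -L.rho (L'.dualDifferential f) := by
  refine VectorFields.ext_of_act fun g ↦ (h.act_differential f g).trans ?_
  ext x
  exact (map_neg (differential g x) (L.rho (L'.dualDifferential f) x)).symm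

theorem br_dualDifferential (h : IsLieBialgebroid L L') (f g : SmoothFun m M) :
    L.br (L'.dualDifferential f) (L'.dualDifferential g) =
      L'.dualDifferential (L.act (L'.dualDifferential f) g) := by
  refine section_ext_of_pairing fun η ↦ ?_
  simp only [h.pairing_br_dualDifferential, L'.pairing_dualDifferential, L'.act_br,
    h.act_differential, L'.act_neg]
  ring

theorem lieDual_dualDifferential (h : IsLieBialgebroid L L') (f : SmoothFun m M)
    (η : Cₛ^∞⟮𝓡 m; F →L[ℝ] ℝ, fun x ↦ A x →L[ℝ] ℝ⟯) :
    Cochain.lieDual L.act L.br pairing (L'.dualDifferential f) η =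
      -L'.br (L.differential f) η := by
  refine representer_pairing'_eq fun Y ↦ ?_
  rw [pairing_neg_left, h.pairing_br_dualDifferential, h.act_differential]
  ring

theorem lieDual_differential (h : IsLieBialgebroid L L') (f : SmoothFun m M)
    (X : Cₛ^∞⟮𝓡 m; F, A⟯) :
    Cochain.lieDual L'.act L'.br pairing' (L.differential f) X =
      -L.br (L'.dualDifferential f) X := by
  refine representer_pairing_eq fun η ↦ ?_
  rw [pairing_neg_right, h.pairing_br_dualDifferential, pairing', pairing']
  ring

end IsLieBialgebroid

end Bialgebroid

section Determinant

variable {S R ι : Type*} [CommRing S] [CommRing R] [Algebra S R] [DecidableEq ι]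

theorem derivation_prod (D : Derivation S R R) (s : Finset ι) (a : ι → R) :
    D (∏ i ∈ s, a i) = ∑ i ∈ s, D (a i) * ∏ j ∈ s.erase i, a j := by
  induction s using Finset.induction_on with
  | empty => simp
  | insert i s hi ih =>
    have herase : ∀ j ∈ s, ∏ k ∈ (insert i s).erase j, a k = a i * ∏ k ∈ s.erase j, a k := by
      intro j hj
      rw [Finset.erase_insert_of_ne (ne_of_mem_of_not_mem hj hi).symm,
        Finset.prod_insert fun h ↦ hi (Finset.mem_of_mem_erase h)]
    rw [Finset.prod_insert hi, D.leibniz, ih, Finset.sum_insert hi, Finset.erase_insert hi,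
      smul_eq_mul, smul_eq_mul, add_comm, mul_comm, Finset.mul_sum]
    refine congrArg _ (Finset.sum_congr rfl fun j hj ↦ ?_)
    rw [herase j hj]
    ring

variable [Fintype ι]

theorem sum_det_updateCol_eq_trace (B P : Matrix ι ι R) :
    ∑ j, (B.updateCol j fun i ↦ P i j).det = (B.adjugate * P).trace := by
  refine Finset.sum_congr rfl fun j _ ↦ ?_
  rw [← Matrix.cramer_apply, Matrix.cramer_eq_adjugate_mulVec]
  rfl

theorem sum_det_updateRow_eq_trace (B P : Matrix ι ι R) :
    ∑ i, (B.updateRow i (P i)).det = (B.adjugate * P).trace := by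
  rw [← Matrix.trace_transpose, Matrix.transpose_mul, Matrix.trace_mul_comm,
    Matrix.adjugate_transpose, ← sum_det_updateCol_eq_trace]
  refine Finset.sum_congr rfl fun i _ ↦ ?_
  rw [← Matrix.det_transpose, ← Matrix.updateCol_transpose]
  rfl

theorem derivation_det (D : Derivation S R R) (B : Matrix ι ι R) :
    D B.det = (B.adjugate * B.map D).trace := by
  have hprod (σ : Equiv.Perm ι) :
      D (∏ i, B (σ i) i) = ∑ j, ∏ i, B.updateCol j (fun i ↦ D (B i j)) (σ i) i := by
    rw [derivation_prod]
    refine Finset.sum_congr rfl fun j _ ↦ ?_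
    rw [← Finset.mul_prod_erase _ _ (Finset.mem_univ j), Matrix.updateCol_self]
    refine congrArg _ (Finset.prod_congr rfl fun i hi ↦ ?_)
    rw [Matrix.updateCol_ne (Finset.ne_of_mem_erase hi)]
  rw [← sum_det_updateCol_eq_trace]
  simp only [Matrix.det_apply', map_sum, Matrix.map_apply]
  rw [Finset.sum_comm]
  refine Finset.sum_congr rfl fun σ _ ↦ ?_
  rw [← Finset.mul_sum, ← hprod, D.leibniz, Derivation.map_intCast, smul_zero, add_zero,
    smul_eq_mul]

theorem derivation_det_of_add (D : Derivation S R R) {B P Q : Matrix ι ι R}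
    (h : ∀ i j, D (B i j) = P i j + Q i j) :
    D B.det = ∑ i, (B.updateRow i (P i)).det + ∑ j, (B.updateCol j fun i ↦ Q i j).det := by
  have hBPQ : B.map D = P + Q := Matrix.ext h
  rw [derivation_det, hBPQ, Matrix.mul_add, Matrix.trace_add, sum_det_updateRow_eq_trace,
    sum_det_updateCol_eq_trace]

end Determinant

section Volume

variable {m n : ℕ} {M : Type*} [TopologicalSpace M] [ChartedSpace (EuclideanSpace ℝ (Fin m)) M]
  {F : Type*} [NormedAddCommGroup F] [NormedSpace ℝ F]
  {A : M → Type*} [∀ x, AddCommGroup (A x)] [∀ x, Module ℝ (A x)] [∀ x, TopologicalSpace (A x)]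
  [TopologicalSpace (TotalSpace F A)] [FiberBundle F A] [VectorBundle ℝ F A]

theorem FormField.eval_update_neg {k : ℕ} (w : FormField m F A k) (Y : Fin k → Cₛ^∞⟮𝓡 m; F, A⟯)
    (i : Fin k) (Z : Cₛ^∞⟮𝓡 m; F, A⟯) :
    w.eval (Function.update Y i (-Z)) = -w.eval (Function.update Y i Z) := by
  have hupdate (x : M) (W : Cₛ^∞⟮𝓡 m; F, A⟯) : (fun j ↦ Function.update Y i W j x) =
      Function.update (fun j ↦ Y j x) i (W x) :=
    Function.comp_update (fun Z : Cₛ^∞⟮𝓡 m; F, A⟯ ↦ Z x) Y i W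
  ext x
  change w.toFun x (fun j ↦ Function.update Y i (-Z) j x) =
    -w.toFun x (fun j ↦ Function.update Y i Z j x)
  rw [hupdate, hupdate, ← AlternatingMap.map_update_neg]
  rfl

theorem FormField.lieForm_neg [IsManifold (𝓡 m) ∞ M] {k : ℕ}
    (s : FormField m (EuclideanSpace ℝ (Fin m)) (fun x : M ↦ TangentSpace (𝓡 m) x) k)
    (Z : VectorFields m M) (Y : Fin k → VectorFields m M) :
    Cochain.lieForm VectorFields.act VectorFields.bracket (-Z) s.eval Y =
      -Cochain.lieForm VectorFields.act VectorFields.bracket Z s.eval Y := by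
  have hact : (-Z).act (s.eval Y) = -Z.act (s.eval Y) := by
    ext x
    exact map_neg (differential (s.eval Y) x) (Z x)
  simp only [Cochain.lieForm, hact, VectorFields.bracket_neg_left, FormField.eval_update_neg,
    Finset.sum_neg_distrib]
  ring

namespace IsDualVolume

variable {Ω : FormField m F A n} {V : FormField m (F →L[ℝ] ℝ) (fun x ↦ A x →L[ℝ] ℝ) n}

theorem eval_mul_eval (h : IsDualVolume Ω V) (X : Fin n → Cₛ^∞⟮𝓡 m; F, A⟯)
    (θ : Fin n → Cₛ^∞⟮𝓡 m; F →L[ℝ] ℝ, fun x ↦ A x →L[ℝ] ℝ⟯) :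
    Ω.eval X * V.eval θ = (Matrix.of fun i j ↦ pairing (θ i) (X j)).det := by
  ext x
  refine (h x (fun i ↦ X i x) fun i ↦ θ i x).trans ?_
  exact (RingHom.map_det ((Pi.evalRingHom (fun _ : M ↦ ℝ) x).comp
    (ContMDiffMap.coeFnRingHom : SmoothFun m M →+* M → ℝ))
      (Matrix.of fun i j ↦ pairing (θ i) (X j))).symm

theorem det_updateRow_pairing (h : IsDualVolume Ω V) (X : Fin n → Cₛ^∞⟮𝓡 m; F, A⟯)
    (θ : Fin n → Cₛ^∞⟮𝓡 m; F →L[ℝ] ℝ, fun x ↦ A x →L[ℝ] ℝ⟯) (i : Fin n)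
    (η : Cₛ^∞⟮𝓡 m; F →L[ℝ] ℝ, fun x ↦ A x →L[ℝ] ℝ⟯) :
    ((Matrix.of fun i j ↦ pairing (θ i) (X j)).updateRow i fun j ↦ pairing η (X j)).det =
      Ω.eval X * V.eval (Function.update θ i η) := by
  rw [h.eval_mul_eval]
  congr 1
  ext1 k j
  obtain rfl | hk := eq_or_ne k i
  · simp
  · simp [hk]

theorem det_updateCol_pairing (h : IsDualVolume Ω V) (X : Fin n → Cₛ^∞⟮𝓡 m; F, A⟯)
    (θ : Fin n → Cₛ^∞⟮𝓡 m; F →L[ℝ] ℝ, fun x ↦ A x →L[ℝ] ℝ⟯) (j : Fin n)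
    (Y : Cₛ^∞⟮𝓡 m; F, A⟯) :
    ((Matrix.of fun i j ↦ pairing (θ i) (X j)).updateCol j fun i ↦ pairing (θ i) Y).det =
      Ω.eval (Function.update X j Y) * V.eval θ := by
  rw [h.eval_mul_eval]
  congr 1
  ext1 i k
  obtain rfl | hk := eq_or_ne k j
  · simp
  · simp [hk]

theorem derivation_eval_mul_eval {S : Type*} [CommRing S] [Algebra S (SmoothFun m M)]
    (h : IsDualVolume Ω V) (D : Derivation S (SmoothFun m M) (SmoothFun m M))
    {X Y : Fin n → Cₛ^∞⟮𝓡 m; F, A⟯}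
    {θ η : Fin n → Cₛ^∞⟮𝓡 m; F →L[ℝ] ℝ, fun x ↦ A x →L[ℝ] ℝ⟯}
    (hD : ∀ i j, D (pairing (θ i) (X j)) = pairing (η i) (X j) + pairing (θ i) (Y j)) :
    D (Ω.eval X * V.eval θ) = Ω.eval X * ∑ i, V.eval (Function.update θ i (η i)) +
      (∑ j, Ω.eval (Function.update X j (Y j))) * V.eval θ := by
  rw [h.eval_mul_eval, derivation_det_of_add D (B := Matrix.of fun i j ↦ pairing (θ i) (X j))
    (P := fun i j ↦ pairing (η i) (X j)) (Q := fun i j ↦ pairing (θ i) (Y j)) hD]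
  simp only [h.det_updateRow_pairing, h.det_updateCol_pairing, Finset.mul_sum, Finset.sum_mul]

theorem exists_eval_mul_eval_ne_zero [IsManifold (𝓡 m) ∞ M] [T2Space M] [FiniteDimensional ℝ F]
    [ContMDiffVectorBundle ∞ F A (𝓡 m)] (hn : Module.finrank ℝ F = n) (h : IsDualVolume Ω V)
    (x : M) : ∃ (X : Fin n → Cₛ^∞⟮𝓡 m; F, A⟯)
      (θ : Fin n → Cₛ^∞⟮𝓡 m; F →L[ℝ] ℝ, fun x ↦ A x →L[ℝ] ℝ⟯),
      (Ω.eval X * V.eval θ) x ≠ 0 := by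
  let Φ := VectorBundle.continuousLinearEquivAt ℝ F A x
  let b := Module.finBasisOfFinrankEq ℝ F hn
  choose X hX using fun i ↦ exists_section_apply_eq (m := m) F x (Φ.symm (b i))
  choose θ hθ using fun i ↦ exists_dualSection_apply_eq (m := m) F x
    ((b.coord i).toContinuousLinearMap.comp (Φ : A x →L[ℝ] F))
  refine ⟨X, θ, ?_⟩
  have hdual : (Matrix.of fun i j ↦ θ i x (X j x)) = 1 := by
    ext i j
    simp [hX, hθ, Matrix.one_apply, Finsupp.single_apply, eq_comm]
  have hdet := h x (fun i ↦ X i x) fun i ↦ θ i x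
  rw [hdual, Matrix.det_one] at hdet
  exact hdet.trans_ne one_ne_zero

end IsDualVolume

end Volume

section Modular

variable {m n : ℕ} {M : Type*} [TopologicalSpace M] [ChartedSpace (EuclideanSpace ℝ (Fin m)) M]
  [IsManifold (𝓡 m) ∞ M] [T2Space M]
  {F : Type*} [NormedAddCommGroup F] [NormedSpace ℝ F] [FiniteDimensional ℝ F]
  {A : M → Type*} [∀ x, AddCommGroup (A x)] [∀ x, Module ℝ (A x)] [∀ x, TopologicalSpace (A x)]
  [TopologicalSpace (TotalSpace F A)] [FiberBundle F A] [VectorBundle ℝ F A]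
  [ContMDiffVectorBundle ∞ F A (𝓡 m)]
  {L : LieAlgebroid m F A} {L' : LieAlgebroid m (F →L[ℝ] ℝ) fun x ↦ A x →L[ℝ] ℝ}

-- `(L_{d⁎f} V) / V = (L_{df} Ω) / Ω`, with denominators cleared.
theorem IsLieBialgebroid.lieMulti_dualDifferential (h : IsLieBialgebroid L L') (f : SmoothFun m M)
    {Ω : FormField m F A n} {V : FormField m (F →L[ℝ] ℝ) (fun x ↦ A x →L[ℝ] ℝ) n}
    (hΩV : IsDualVolume Ω V) (X : Fin n → Cₛ^∞⟮𝓡 m; F, A⟯)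
    (η : Fin n → Cₛ^∞⟮𝓡 m; F →L[ℝ] ℝ, fun x ↦ A x →L[ℝ] ℝ⟯) :
    Ω.eval X * Cochain.lieMulti L.act L.br pairing (L'.dualDifferential f) V.eval η =
      V.eval η * Cochain.lieMulti L'.act L'.br pairing' (L.differential f) Ω.eval X := by
  have hpairing i j : L.act (L'.dualDifferential f) (pairing (η i) (X j)) =
      pairing (-L'.br (L.differential f) (η i)) (X j) +
        pairing (η i) (L.br (L'.dualDifferential f) (X j)) := by
    rw [pairing_neg_left, h.pairing_br_dualDifferential, h.act_differential]
    ring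
  have hΩV' := hΩV.derivation_eval_mul_eval (L.rho (L'.dualDifferential f)).toDerivation hpairing
  change L.act (L'.dualDifferential f) _ = _ at hΩV'
  simp only [Cochain.lieMulti, h.lieDual_dualDifferential, h.lieDual_differential,
    FormField.eval_update_neg, h.act_differential, Finset.sum_neg_distrib] at hΩV' ⊢
  rw [L.act_mul] at hΩV'
  linear_combination hΩV'

end Modular

section PoissonStructure

variable {m : ℕ} {M : Type*} [TopologicalSpace M] [ChartedSpace (EuclideanSpace ℝ (Fin m)) M]
  [IsManifold (𝓡 m) ∞ M] [T2Space M]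
  {F : Type*} [NormedAddCommGroup F] [NormedSpace ℝ F] [FiniteDimensional ℝ F]
  {A : M → Type*} [∀ x, AddCommGroup (A x)] [∀ x, Module ℝ (A x)] [∀ x, TopologicalSpace (A x)]
  [TopologicalSpace (TotalSpace F A)] [FiberBundle F A] [VectorBundle ℝ F A]
  [ContMDiffVectorBundle ∞ F A (𝓡 m)]

namespace LieAlgebroid

variable (L : LieAlgebroid m F A) (L' : LieAlgebroid m (F →L[ℝ] ℝ) fun x ↦ A x →L[ℝ] ℝ)

theorem anchorTranspose_apply_section (α : OneForms m M) (x : M) :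
    L'.anchorTranspose x (α x) = L'.anchorTransposeSection α x := by
  refine Cochain.representer_eq (fun φ ↦ ?_) fun _ ↦ dual_separates F x
  obtain ⟨η, rfl⟩ := exists_dualSection_apply_eq (m := m) F x φ
  exact DFunLike.congr_fun (L'.pairing_anchorTransposeSection α η) x

theorem apply_anchorTranspose (x : M) (α : TangentSpace (𝓡 m) x →L[ℝ] ℝ) (φ : A x →L[ℝ] ℝ) :
    φ (L'.anchorTranspose x α) = α (L'.anchor x φ) := by
  obtain ⟨f, rfl⟩ := exists_differential_eq x α
  obtain ⟨η, rfl⟩ := exists_dualSection_apply_eq (m := m) F x φ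
  rw [anchorTranspose_apply_section]
  exact DFunLike.congr_fun (L'.pairing_dualDifferential f η) x

/-- The bundle map `ρ ∘ (ρ⁎)* : T*M → TM` on the fibre over `x`. -/
noncomputable def anchorCompTranspose (x : M) :
    (TangentSpace (𝓡 m) x →L[ℝ] ℝ) →L[ℝ] TangentSpace (𝓡 m) x :=
  let T : (TangentSpace (𝓡 m) x →L[ℝ] ℝ) →ₗ[ℝ] A x :=
    { toFun := L'.anchorTranspose x
      map_add' := fun α β ↦ dual_separates F x fun φ ↦ by
        simp only [map_add, apply_anchorTranspose, add_apply]
      map_smul' := fun c α ↦ dual_separates F x fun φ ↦ by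
        simp only [map_smul, apply_anchorTranspose, smul_apply,
          RingHom.id_apply] }
  ⟨(L.anchor x).toLinearMap ∘ₗ T, continuous_of_linear_of_fiber
    (E := fun x : M ↦ TangentSpace (𝓡 m) x →L[ℝ] ℝ) (EuclideanSpace ℝ (Fin m) →L[ℝ] ℝ) _⟩

theorem anchorCompTranspose_apply_section (α : OneForms m M) (x : M) :
    L.anchorCompTranspose L' x (α x) = L.rho (L'.anchorTransposeSection α) x :=
  congrArg (L.anchor x) (L'.anchorTranspose_apply_section α x)

end LieAlgebroid

namespace IsLieBialgebroid

variable {L : LieAlgebroid m F A} {L' : LieAlgebroid m (F →L[ℝ] ℝ) fun x ↦ A x →L[ℝ] ℝ}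

/-- The Poisson bivector `π` on the base of a Lie bialgebroid, `π♯ = ρ ∘ (ρ⁎)*`. -/
noncomputable def bivector (h : IsLieBialgebroid L L') : BivectorField m M where
  sharp :=
    { toFun := L.anchorCompTranspose L'
      contMDiff_toFun := contMDiff_hom_of_apply (F := EuclideanSpace ℝ (Fin m) →L[ℝ] ℝ)
        (E := fun x : M ↦ TangentSpace (𝓡 m) x →L[ℝ] ℝ) (F' := EuclideanSpace ℝ (Fin m))
        (E' := fun x : M ↦ TangentSpace (𝓡 m) x) (L.anchorCompTranspose L') fun α ↦
          (L.rho (L'.anchorTransposeSection α)).contMDiff.congr fun x ↦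
            congrArg _ (L.anchorCompTranspose_apply_section L' α x) }
  skew x α β := by
    obtain ⟨f, rfl⟩ := exists_differential_eq x α
    obtain ⟨g, rfl⟩ := exists_differential_eq x β
    change differential g x (L.anchorCompTranspose L' x (differential f x)) =
      -differential f x (L.anchorCompTranspose L' x (differential g x))
    rw [L.anchorCompTranspose_apply_section, L.anchorCompTranspose_apply_section]
    exact DFunLike.congr_fun (h.act_dualDifferential_skew f g) x

theorem bivector_ham (h : IsLieBialgebroid L L') (f : SmoothFun m M) :
    h.bivector.ham f = L.rho (L'.dualDifferential f) := by
  ext x : 1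
  exact L.anchorCompTranspose_apply_section L' (differential f) x

theorem bivector_poissonBracket (h : IsLieBialgebroid L L') (f g : SmoothFun m M) :
    h.bivector.poissonBracket f g = L.act (L'.dualDifferential f) g :=
  congrArg (fun X ↦ VectorFields.act X g) (h.bivector_ham f)

theorem bivector_isPoisson (h : IsLieBialgebroid L L') : h.bivector.IsPoisson := by
  intro f g k
  simp only [h.bivector_poissonBracket, ← h.br_dualDifferential, L.act_br]
  ring

end IsLieBialgebroid

theorem FormField.exists_eval_ne_zero {k : ℕ} {w : FormField m F A k} {x : M}
    (hw : w.toFun x ≠ 0) : ∃ X : Fin k → Cₛ^∞⟮𝓡 m; F, A⟯, w.eval X x ≠ 0 := by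
  obtain ⟨v, hv⟩ := DFunLike.exists_ne hw
  choose X hX using fun i ↦ exists_section_apply_eq (m := m) F x (v i)
  obtain rfl : v = fun i ↦ X i x := funext fun i ↦ (hX i).symm
  exact ⟨X, hv⟩

theorem BivectorField.IsModularVectorField.eq {P : BivectorField m M}
    {s : FormField m (EuclideanSpace ℝ (Fin m)) (fun x : M ↦ TangentSpace (𝓡 m) x) m}
    (hs : ∀ x, s.toFun x ≠ 0) {Z Z' : VectorFields m M}
    (hZ : P.IsModularVectorField s Z) (hZ' : P.IsModularVectorField s Z') : Z = Z' := by
  refine VectorFields.ext_of_act fun f ↦ ?_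
  ext x
  obtain ⟨Y, hY⟩ := FormField.exists_eval_ne_zero (hs x)
  exact mul_right_cancel₀ hY (DFunLike.congr_fun ((hZ f Y).symm.trans (hZ' f Y)) x)

end PoissonStructure

section ModularVectorField

variable {m n : ℕ} {M : Type*} [TopologicalSpace M] [ChartedSpace (EuclideanSpace ℝ (Fin m)) M]
  [IsManifold (𝓡 m) ∞ M] [T2Space M]
  {F : Type*} [NormedAddCommGroup F] [NormedSpace ℝ F] [FiniteDimensional ℝ F]
  {A : M → Type*} [∀ x, AddCommGroup (A x)] [∀ x, Module ℝ (A x)] [∀ x, TopologicalSpace (A x)]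
  [TopologicalSpace (TotalSpace F A)] [FiberBundle F A] [VectorBundle ℝ F A]
  [ContMDiffVectorBundle ∞ F A (𝓡 m)]
  {L : LieAlgebroid m F A} {L' : LieAlgebroid m (F →L[ℝ] ℝ) fun x ↦ A x →L[ℝ] ℝ}
  {s : FormField m (EuclideanSpace ℝ (Fin m)) (fun x : M ↦ TangentSpace (𝓡 m) x) m}
  {Ω : FormField m F A n} {V : FormField m (F →L[ℝ] ℝ) (fun x ↦ A x →L[ℝ] ℝ) n}
  {X₀ : Cₛ^∞⟮𝓡 m; F, A⟯} {ξ₀ : Cₛ^∞⟮𝓡 m; F →L[ℝ] ℝ, fun x ↦ A x →L[ℝ] ℝ⟯}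

theorem IsLieBialgebroid.two_mul_lieForm_dualDifferential (h : IsLieBialgebroid L L')
    (hn : Module.finrank ℝ F = n) (hΩV : IsDualVolume Ω V) (hX₀ : IsDualModularCocycle L' s Ω X₀)
    (hξ₀ : IsModularCocycle L s V ξ₀) (f : SmoothFun m M) (Y : Fin m → VectorFields m M) :
    2 * Cochain.lieForm VectorFields.act VectorFields.bracket (L.rho (L'.dualDifferential f))
      s.eval Y = (L'.act ξ₀ f - L.act X₀ f) * s.eval Y := by
  ext x
  obtain ⟨X, η, hne⟩ := hΩV.exists_eval_mul_eval_ne_zero hn x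
  have hξ := hξ₀ (L'.dualDifferential f) Y η
  have hX := hX₀ (L.differential f) X Y
  rw [h.rho_differential, FormField.lieForm_neg, L.pairing_differential] at hX
  rw [L'.pairing_dualDifferential] at hξ
  have hcancel := h.lieMulti_dualDifferential f hΩV X η
  have hmul : (Ω.eval X * V.eval η) * (2 * Cochain.lieForm VectorFields.act VectorFields.bracket
      (L.rho (L'.dualDifferential f)) s.eval Y) =
        (Ω.eval X * V.eval η) * ((L'.act ξ₀ f - L.act X₀ f) * s.eval Y) := by
    linear_combination Ω.eval X * hξ - V.eval η * hX - s.eval Y * hcancel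
  exact mul_left_cancel₀ hne (DFunLike.congr_fun hmul x)

theorem IsLieBialgebroid.isModularVectorField (h : IsLieBialgebroid L L')
    (hn : Module.finrank ℝ F = n) (hΩV : IsDualVolume Ω V) (hX₀ : IsDualModularCocycle L' s Ω X₀)
    (hξ₀ : IsModularCocycle L s V ξ₀) :
    h.bivector.IsModularVectorField s ((1 / 2 : ℝ) • (L'.rho ξ₀ - L.rho X₀)) := by
  intro f Y
  have htwo := h.two_mul_lieForm_dualDifferential hn hΩV hX₀ hξ₀ f Y
  rw [h.bivector_ham, VectorFields.smul_sub_act, smul_mul_assoc]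
  refine Eq.trans ?_ (congrArg ((1 / 2 : ℝ) • ·) htwo)
  rw [two_mul, ← two_smul ℝ, smul_smul, one_div_mul_cancel two_ne_zero, one_smul]

end ModularVectorField

theorem corollary2p7_general {m n : ℕ} {M : Type*} [TopologicalSpace M] [T2Space M]
    [ChartedSpace (EuclideanSpace ℝ (Fin m)) M] [IsManifold (𝓡 m) ∞ M]
    {F : Type*} [NormedAddCommGroup F] [NormedSpace ℝ F] [FiniteDimensional ℝ F]
    {A : M → Type*} [∀ x, AddCommGroup (A x)] [∀ x, Module ℝ (A x)] [∀ x, TopologicalSpace (A x)]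
    [TopologicalSpace (TotalSpace F A)] [FiberBundle F A] [VectorBundle ℝ F A]
    [ContMDiffVectorBundle ∞ F A (𝓡 m)] (hn : Module.finrank ℝ F = n)
    (L : LieAlgebroid m F A) (L' : LieAlgebroid m (F →L[ℝ] ℝ) fun x ↦ A x →L[ℝ] ℝ)
    (hLL' : IsLieBialgebroid L L')
    (s : FormField m (EuclideanSpace ℝ (Fin m)) (fun x : M ↦ TangentSpace (𝓡 m) x) m)
    (hs : ∀ x, s.toFun x ≠ 0)
    (Ω : FormField m F A n) (V : FormField m (F →L[ℝ] ℝ) (fun x ↦ A x →L[ℝ] ℝ) n)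
    (hΩV : IsDualVolume Ω V)
    (X₀ : Cₛ^∞⟮𝓡 m; F, A⟯) (hX₀ : IsDualModularCocycle L' s Ω X₀)
    (ξ₀ : Cₛ^∞⟮𝓡 m; F →L[ℝ] ℝ, fun x ↦ A x →L[ℝ] ℝ⟯) (hξ₀ : IsModularCocycle L s V ξ₀) :
    ∃ P : BivectorField m M,
      (∀ x α, P.sharp x α = L.anchor x (L'.anchorTranspose x α)) ∧ P.IsPoisson ∧
        ∀ Z : VectorFields m M,
          P.IsModularVectorField s Z ↔ Z = (1 / 2 : ℝ) • (L'.rho ξ₀ - L.rho X₀) := by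
  have hmodular := hLL'.isModularVectorField hn hΩV hX₀ hξ₀
  exact ⟨hLL'.bivector, fun _ _ ↦ rfl, hLL'.bivector_isPoisson, fun _ ↦
    ⟨fun hZ ↦ hZ.eq hs hmodular, fun hZ ↦ hZ ▸ hmodular⟩⟩

theorem corollary2p7 {m n : ℕ} {M : Type*} [TopologicalSpace M] [T2Space M]
    [SecondCountableTopology M] [ChartedSpace (EuclideanSpace ℝ (Fin m)) M]
    [IsManifold (𝓡 m) ∞ M]
    {A : M → Type*} [∀ x, AddCommGroup (A x)] [∀ x, Module ℝ (A x)]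
    [∀ x, TopologicalSpace (A x)] [TopologicalSpace (TotalSpace (EuclideanSpace ℝ (Fin n)) A)]
    [FiberBundle (EuclideanSpace ℝ (Fin n)) A] [VectorBundle ℝ (EuclideanSpace ℝ (Fin n)) A]
    [ContMDiffVectorBundle ∞ (EuclideanSpace ℝ (Fin n)) A (𝓡 m)]
    -- a Lie bialgebroid `(A, A*)`
    (L : LieAlgebroid m (EuclideanSpace ℝ (Fin n)) A)
    (L' : LieAlgebroid m (EuclideanSpace ℝ (Fin n) →L[ℝ] ℝ) fun x ↦ A x →L[ℝ] ℝ)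
    (hLL' : IsLieBialgebroid L L')
    -- a volume form `s` on `M`
    (s : FormField m (EuclideanSpace ℝ (Fin m)) (fun x : M ↦ TangentSpace (𝓡 m) x) m)
    (hs : ∀ x, s.toFun x ≠ 0)
    -- a nowhere vanishing section `Ω` of the top exterior power of `A*`, and the dual section `V`
    (Ω : FormField m (EuclideanSpace ℝ (Fin n)) A n) (hΩ : ∀ x, Ω.toFun x ≠ 0)
    (V : FormField m (EuclideanSpace ℝ (Fin n) →L[ℝ] ℝ) (fun x ↦ A x →L[ℝ] ℝ) n)
    (hΩV : IsDualVolume Ω V)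
    -- the modular cocycles `X₀` of `A*` and `ξ₀` of `A`
    (X₀ : Cₛ^∞⟮𝓡 m; EuclideanSpace ℝ (Fin n), A⟯) (hX₀ : IsDualModularCocycle L' s Ω X₀)
    (ξ₀ : Cₛ^∞⟮𝓡 m; EuclideanSpace ℝ (Fin n) →L[ℝ] ℝ, fun x ↦ A x →L[ℝ] ℝ⟯)
    (hξ₀ : IsModularCocycle L s V ξ₀) :
    -- the associated Poisson bivector `π = P`, with `π♯ = ρ ∘ (ρ⁎)*`, and its modular vector field
    ∃ P : BivectorField m M,
      (∀ x α, P.sharp x α = L.anchor x (L'.anchorTranspose x α)) ∧ P.IsPoisson ∧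
        ∀ Z : VectorFields m M,
          P.IsModularVectorField s Z ↔ Z = (1 / 2 : ℝ) • (L'.rho ξ₀ - L.rho X₀) :=
  corollary2p7_general finrank_euclideanSpace_fin L L' hLL' s hs Ω V hΩV X₀ hX₀ ξ₀ hξ₀
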